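/- Let $\Omega=(0,1)^2$, $\tilde W>0$ and $0<d<1/2$. Let $T_d(t)=\min\{t/d,\,1,\,(1-t)/d\}$ for $t\in[0,1]$, and define $g_d=((g_d)_1,(g_d)_2):\partial\Omega\to\mathbb{R}^2$ by $g_d(x,y)=(T_d(x),0)$ on the horizontal edges $y\in\{0,1\}$ and $g_d(x,y)=(-T_d(y),0)$ on the vertical edges $x\in\{0,1\}$. For $q\in W^{1,2}(\Omega)\cap C^\infty(\Omega)$, $\tau>0$ and $g:\partial\Omega\to\mathbb{R}$ bounded and measurable put $$J(q;\tau,g)=\int_\Omega|\nabla q|^2+\int_{\partial\Omega}\tau\,(q-g)^2,$$ where the boundary values of $q$ are those of its trace. Let $\mathbf{Q}_\infty$ be a field on $\Omega$ of symmetric traceless $2\times2$ matrices such that, within the class $W^{1,2}(\Omega)\cap C^\infty(\Omega)$, the entry $(\mathbf{Q}_\infty)_{11}$ minimizes $J(\cdot\,;\tilde W,(g_d)_1)$ and the entry $(\mathbf{Q}_\infty)_{12}$ minimizes $J(\cdot\,;\tilde W,(g_d)_2)$. Such a field $\mathbf{Q}_\infty$ exists and is unique. The boundary data satisfy $(g_d)_2\equiv0$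 and $$(g_d)_1(x,y)=-(g_d)_1(y,x)=-(g_d)_1(1-y,1-x),\qquad (x,y)\in\partial\Omega .$$ Moreover $(\mathbf{Q}_\infty)_{12}\equiv0$ and $$(\mathbf{Q}_\infty)_{11}(x,y)=-(\mathbf{Q}_\infty)_{11}(y,x)=-(\mathbf{Q}_\infty)_{11}(1-y,1-x),$$ at every point of $\Omega$ and, in the sense of traces, almost everywhere on $\partial\Omega$. Consequently $$(\mathbf{Q}_\infty)_{11}(x,x)=0=(\mathbf{Q}_\infty)_{11}(x,1-x)\qquad\text{for all }x\in(0,1),$$ so that the whole tensor $\mathbf{Q}_\infty$ vanishes along the two diagonals $y=x$ and $y=1-x$ of the square. -/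

import Mathlib

open MeasureTheory Filter Topology Set
open scoped ContDiff

namespace WeakAnchoring

noncomputable section

/-- The open unit square, i.e. the interior of `[0,1] × [0,1]`. -/
def square : Set (ℝ × ℝ) := Ioo 0 1 ×ˢ Ioo 0 1

/-- The boundary of the unit square. -/
def squareBoundary : Set (ℝ × ℝ) := (Icc 0 1 ×ˢ Icc 0 1) \ square

/-- Lebesgue measure on the square. -/
def area : Measure (ℝ × ℝ) := volume.restrict square

/-- Lebesgue measure on `[0,1]`, used to parametrize each edge by arc length. -/
def edgeLength : Measure ℝ := volume.restrict (Icc 0 1)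

/-- Arc length on the boundary of the square: the sum over the bottom, top, left and right edge. -/
def arcLength : Measure (ℝ × ℝ) :=
  edgeLength.map (fun t => (t, 0)) + edgeLength.map (fun t => (t, 1)) +
    edgeLength.map (fun t => (0, t)) + edgeLength.map (fun t => (1, t))

/-- The classical partial derivative in `x`. -/
def dx (q : ℝ × ℝ → ℝ) (p : ℝ × ℝ) : ℝ := fderiv ℝ q p (1, 0)

/-- The classical partial derivative in `y`. -/
def dy (q : ℝ × ℝ → ℝ) (p : ℝ × ℝ) : ℝ := fderiv ℝ q p (0, 1)

/-- `φ` is a test function on the square: `φ ∈ C_c^∞` with support inside the open square. -/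
def IsTest (φ : ℝ × ℝ → ℝ) : Prop :=
  ContDiff ℝ ∞ φ ∧ HasCompactSupport φ ∧ tsupport φ ⊆ square

/-- The Sobolev space `W^{1,2}` of the square: `q ∈ L²` has weak partial derivatives
`w₁, w₂ ∈ L²`. -/
def MemW12 (q : ℝ × ℝ → ℝ) : Prop :=
  MemLp q 2 area ∧ ∃ w₁ w₂ : ℝ × ℝ → ℝ, MemLp w₁ 2 area ∧ MemLp w₂ 2 area ∧
    ∀ φ, IsTest φ →
      ∫ p, q p * dx φ p ∂area = -∫ p, w₁ p * φ p ∂area ∧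
      ∫ p, q p * dy φ p ∂area = -∫ p, w₂ p * φ p ∂area

/-- The class `W^{1,2} ∩ C^∞` (interior) on which the energy is minimized. Values of `q` off the
open square are irrelevant. -/
def Admissible (q : ℝ × ℝ → ℝ) : Prop := ContDiffOn ℝ ∞ q square ∧ MemW12 q

/-- `t ∈ L²` (boundary) is the Sobolev trace of `q`, a function that is smooth in the open square:
there are functions `φ n`, smooth up to the boundary, that converge to `q` in `W^{1,2}` and
whose boundary values converge to `t` in `L²` of the boundary. -/
def IsTrace (q t : ℝ × ℝ → ℝ) : Prop :=
  MemLp t 2 arcLength ∧ ∃ φ : ℕ → ℝ × ℝ → ℝ, (∀ n, ContDiff ℝ ∞ (φ n)) ∧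
    Tendsto (fun n => eLpNorm (fun p => φ n p - q p) 2 area) atTop (𝓝 0) ∧
    Tendsto (fun n => eLpNorm (fun p => dx (φ n) p - dx q p) 2 area) atTop (𝓝 0) ∧
    Tendsto (fun n => eLpNorm (fun p => dy (φ n) p - dy q p) 2 area) atTop (𝓝 0) ∧
    Tendsto (fun n => eLpNorm (fun p => φ n p - t p) 2 arcLength) atTop (𝓝 0)

open Classical in
/-- The trace of `q`, well defined almost everywhere on the boundary for every admissible `q`
by the trace theorem. -/
def trace (q : ℝ × ℝ → ℝ) : ℝ × ℝ → ℝ :=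
  if h : ∃ t, IsTrace q t then h.choose else 0

/-- `J(q; τ, g) = ∫_Ω |∇q|² + ∫_∂Ω τ (q - g)²`. -/
def J (q : ℝ × ℝ → ℝ) (τ : ℝ) (g : ℝ × ℝ → ℝ) : ℝ :=
  ∫ p, (dx q p ^ 2 + dy q p ^ 2) ∂area + ∫ p, τ * (trace q p - g p) ^ 2 ∂arcLength

/-- `q` is a minimizer of `J(·; τ, g)` in the admissible class. -/
def IsArgMin (τ : ℝ) (g q : ℝ × ℝ → ℝ) : Prop :=
  Admissible q ∧ ∀ r, Admissible r → J q τ g ≤ J r τ g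

/-- The trapezoidal function `T_d`. -/
def trapezoid (d t : ℝ) : ℝ := min (t / d) (min 1 ((1 - t) / d))

open Classical in
/-- The boundary datum `g_d` on the unit square, with its two components: `(T_d(x), 0)` on the
horizontal edges and `(-T_d(y), 0)` on the vertical ones (`(0, 0)` at the corners). Values off the
boundary are irrelevant. -/
def gBdry (d : ℝ) (p : ℝ × ℝ) : ℝ × ℝ :=
  if p.2 = 0 ∨ p.2 = 1 then (trapezoid d p.1, 0)
  else if p.1 = 0 ∨ p.1 = 1 then (-trapezoid d p.2, 0)
  else 0

/-- `Q` is a limiting profile with reduced anchoring coefficient `W`: a field of symmetric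
traceless `2 × 2` matrices whose entries `Q₁₁` and `Q₁₂` minimize `J(·; W, (g_d)₁)` and
`J(·; W, (g_d)₂)`. -/
structure IsLimitProfile (W d : ℝ) (Q : ℝ × ℝ → Matrix (Fin 2) (Fin 2) ℝ) : Prop where
  symm : ∀ p ∈ square, (Q p).IsSymm
  traceless : ∀ p ∈ square, (Q p).trace = 0
  min11 : IsArgMin W (fun p => (gBdry d p).1) (fun p => Q p 0 0)
  min12 : IsArgMin W (fun p => (gBdry d p).2) (fun p => Q p 0 1)

end

end WeakAnchoring

/-! The symmetry comes from uniqueness. Each of the two reflections in the diagonals preserves area,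
arc length and `|∇φ|²`, and changes the sign of `(g_d)₁`. Hence `φ ↦ -φ ∘ σ` leaves the energy
unchanged and must fix the unique minimizer. Points of a diagonal are fixed by the corresponding
reflection, so there `q = -q` and `q = 0`. For the zero datum the same argument with `σ = id` gives
`q = 0` everywhere.

Uniqueness and existence both rest on the parallelogram identity `smoothEnergy_parallelogram`: any
two minimizing sequences, made of functions smooth up to the boundary, approach each other in
`W^{1,2}` and in `L²` of the boundary (`IsMinimizing.tendsto_dist`). Working with such sequences
loses nothing, because shrinking the argument towards the centre of the square shows that these
functions are dense in the admissible class (`Admissible.exists_contDiff_tendsto`). The trace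
inequality then gives existence and uniqueness of traces, and a Poincaré inequality with a boundary
term controls the `L²` norm by the energy.

The admissible class is not closed under `W^{1,2}` limits, so the limit of a minimizing sequence has
to be shown smooth. By the Euler–Lagrange equation it is weakly harmonic, and Weyl's lemma (`weyl`)
provides a smooth representative. -/

namespace WeakAnchoring
noncomputable section

/-! ### Convergence and completeness in `L²` -/

section L2

variable {α : Type*} [MeasurableSpace α] {μ : Measure α}

/-- Convergence in `L²(μ)` of a sequence of functions. -/
structure L2Tendsto (μ : Measure α) (f : ℕ → α → ℝ) (F : α → ℝ) : Prop where
  memLp : ∀ n, MemLp (f n) 2 μ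
  memLp_lim : MemLp F 2 μ
  tendsto : Tendsto (fun n => eLpNorm (fun p => f n p - F p) 2 μ) atTop (𝓝 0)

theorem integral_mul_eq_inner {f g : α → ℝ} (hf : MemLp f 2 μ) (hg : MemLp g 2 μ) :
    ∫ p, f p * g p ∂μ = inner ℝ (hf.toLp f) (hg.toLp g) := by
  rw [L2.inner_def]
  refine integral_congr_ae ?_
  filter_upwards [hf.coeFn_toLp, hg.coeFn_toLp] with p h1 h2
  simp [h1, h2, mul_comm]

theorem norm_toLp_sq {f : α → ℝ} (hf : MemLp f 2 μ) : ‖hf.toLp f‖ ^ 2 = ∫ p, f p ^ 2 ∂μ := by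
  rw [← real_inner_self_eq_norm_sq, ← integral_mul_eq_inner hf hf]
  simp only [sq]

theorem tendsto_eLpNorm_iff_integral_sq {f : ℕ → α → ℝ} (hf : ∀ n, MemLp (f n) 2 μ) :
    Tendsto (fun n => eLpNorm (f n) 2 μ) atTop (𝓝 0) ↔
      Tendsto (fun n => ∫ p, f n p ^ 2 ∂μ) atTop (𝓝 0) := by
  have h1 : ∀ n, eLpNorm (f n) 2 μ = ENNReal.ofReal ‖(hf n).toLp (f n)‖ := fun n => by
    rw [Lp.norm_toLp, ENNReal.ofReal_toReal (hf n).eLpNorm_ne_top]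
  simp only [h1, ← fun n => norm_toLp_sq (hf n)]
  constructor
  · intro h
    have := (ENNReal.tendsto_toReal ENNReal.zero_ne_top).comp h
    simpa [Function.comp_def] using this.pow 2
  · intro h
    have h2 := (Real.continuous_sqrt.tendsto 0).comp h
    simp only [Function.comp_def, Real.sqrt_sq (norm_nonneg _), Real.sqrt_zero] at h2
    simpa using ENNReal.tendsto_ofReal h2

theorem L2Tendsto.tendsto_toLp {f : ℕ → α → ℝ} {F : α → ℝ} (h : L2Tendsto μ f F) :
    Tendsto (fun n => (h.memLp n).toLp (f n)) atTop (𝓝 (h.memLp_lim.toLp F)) :=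
  (Lp.tendsto_Lp_iff_tendsto_eLpNorm'' f h.memLp F h.memLp_lim).2 h.tendsto

theorem L2Tendsto.integral_mul {f g : ℕ → α → ℝ} {F G : α → ℝ} (hf : L2Tendsto μ f F)
    (hg : L2Tendsto μ g G) :
    Tendsto (fun n => ∫ p, f n p * g n p ∂μ) atTop (𝓝 (∫ p, F p * G p ∂μ)) := by
  simp only [fun n => integral_mul_eq_inner (hf.memLp n) (hg.memLp n),
    integral_mul_eq_inner hf.memLp_lim hg.memLp_lim]
  exact hf.tendsto_toLp.inner hg.tendsto_toLp

theorem L2Tendsto.integral_sq {f : ℕ → α → ℝ} {F : α → ℝ} (hf : L2Tendsto μ f F) :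
    Tendsto (fun n => ∫ p, f n p ^ 2 ∂μ) atTop (𝓝 (∫ p, F p ^ 2 ∂μ)) := by
  simpa only [sq] using hf.integral_mul hf

theorem L2Tendsto.const {F : α → ℝ} (hF : MemLp F 2 μ) : L2Tendsto μ (fun _ => F) F :=
  ⟨fun _ => hF, hF, by simp⟩

theorem L2Tendsto.sub {f g : ℕ → α → ℝ} {F G : α → ℝ} (hf : L2Tendsto μ f F)
    (hg : L2Tendsto μ g G) :
    L2Tendsto μ (fun n p => f n p - g n p) (fun p => F p - G p) := by
  have h0 := hf.tendsto.add hg.tendsto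
  rw [add_zero] at h0
  have h1 : ∀ n, eLpNorm (fun p => (f n p - g n p) - (F p - G p)) 2 μ ≤
      eLpNorm (fun p => f n p - F p) 2 μ + eLpNorm (fun p => g n p - G p) 2 μ := fun n => by
    have h2 : (fun p => (f n p - g n p) - (F p - G p)) =
        (fun p => f n p - F p) - fun p => g n p - G p := by
      ext p
      simp only [Pi.sub_apply]
      ring
    rw [h2]
    exact eLpNorm_sub_le ((hf.memLp n).sub hf.memLp_lim).1 ((hg.memLp n).sub hg.memLp_lim).1
      (by norm_num)
  exact ⟨fun n => (hf.memLp n).sub (hg.memLp n), hf.memLp_lim.sub hg.memLp_lim,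
    tendsto_of_tendsto_of_tendsto_of_le_of_le tendsto_const_nhds h0 (fun n => bot_le) h1⟩

theorem L2Tendsto.neg {f : ℕ → α → ℝ} {F : α → ℝ} (hf : L2Tendsto μ f F) :
    L2Tendsto μ (fun n p => -f n p) (fun p => -F p) := by
  simpa using (L2Tendsto.const (MemLp.zero' (μ := μ) (p := 2))).sub hf

theorem L2Tendsto.comp {β : Type*} [MeasurableSpace β] {ν : Measure β} {σ : β → α}
    (hσ : MeasurePreserving σ ν μ) {f : ℕ → α → ℝ} {F : α → ℝ} (hf : L2Tendsto μ f F) :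
    L2Tendsto ν (fun n p => f n (σ p)) (fun p => F (σ p)) := by
  refine ⟨fun n => (hf.memLp n).comp_measurePreserving hσ,
    hf.memLp_lim.comp_measurePreserving hσ, ?_⟩
  refine hf.tendsto.congr fun n => ?_
  exact (eLpNorm_comp_measurePreserving ((hf.memLp n).sub hf.memLp_lim).1 hσ).symm

theorem L2Tendsto.congr_lim {f : ℕ → α → ℝ} {F F' : α → ℝ} (hf : L2Tendsto μ f F)
    (h : F =ᵐ[μ] F') : L2Tendsto μ f F' := by
  refine ⟨hf.memLp, (memLp_congr_ae h).1 hf.memLp_lim, hf.tendsto.congr fun n => ?_⟩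
  refine eLpNorm_congr_ae ?_
  filter_upwards [h] with p hp
  rw [hp]

/-- The common source of the uniqueness statements: it is applied to two approximations of one trace
and to two minimizing sequences. -/
theorem L2Tendsto.ae_eq {f g : ℕ → α → ℝ} {F G : α → ℝ} (hf : L2Tendsto μ f F)
    (hg : L2Tendsto μ g G)
    (h : Tendsto (fun n => ∫ p, (f n p - g n p) ^ 2 ∂μ) atTop (𝓝 0)) : F =ᵐ[μ] G := by
  have h1 := tendsto_nhds_unique (hf.sub hg).integral_sq h
  have h2 := (integral_eq_zero_iff_of_nonneg (fun p => sq_nonneg (F p - G p))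
    ((hf.sub hg).memLp_lim.integrable_sq)).1 h1
  filter_upwards [h2] with p hp
  simpa [sub_eq_zero] using hp

/-- Completeness of `L²`. -/
theorem exists_L2Tendsto {f : ℕ → α → ℝ} (hf : ∀ n, MemLp (f n) 2 μ)
    (h : Tendsto (fun n : ℕ × ℕ => ∫ p, (f n.1 p - f n.2 p) ^ 2 ∂μ) atTop (𝓝 0)) :
    ∃ F, L2Tendsto μ f F := by
  have hc : CauchySeq fun n => (hf n).toLp (f n) := by
    rw [cauchySeq_iff_tendsto_dist_atTop_0]
    have h2 := (Real.continuous_sqrt.tendsto 0).comp h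
    rw [Real.sqrt_zero] at h2
    refine h2.congr fun n => ?_
    rw [dist_eq_norm, ← MemLp.toLp_sub (hf n.1) (hf n.2), ← Real.sqrt_sq (norm_nonneg _),
      norm_toLp_sq ((hf n.1).sub (hf n.2))]
    rfl
  obtain ⟨F, hF⟩ := cauchySeq_tendsto_of_complete hc
  refine ⟨F, hf, Lp.memLp F, ?_⟩
  refine (Lp.tendsto_Lp_iff_tendsto_eLpNorm'' f hf F (Lp.memLp F)).1 ?_
  rwa [Lp.toLp_coeFn]

end L2

/-! ### Area and arc length of the square -/

theorem isOpen_square : IsOpen square := isOpen_Ioo.prod isOpen_Ioo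

theorem measurableSet_square : MeasurableSet square := isOpen_square.measurableSet

instance : IsProbabilityMeasure edgeLength := ⟨by simp [edgeLength]⟩

theorem area_eq_prod : area = edgeLength.prod edgeLength := by
  rw [area, square, edgeLength, Measure.volume_eq_prod, Measure.prod_restrict]
  exact Measure.restrict_congr_set (Measure.set_prod_ae_eq Ioo_ae_eq_Icc Ioo_ae_eq_Icc)

instance : IsProbabilityMeasure area := by rw [area_eq_prod]; infer_instance

instance : IsFiniteMeasure arcLength := by unfold arcLength; infer_instance

theorem ae_edgeLength : ∀ᵐ t ∂edgeLength, t ∈ Icc (0 : ℝ) 1 := ae_restrict_mem measurableSet_Icc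

theorem ae_arcLength {P : ℝ × ℝ → Prop} (h1 : ∀ᵐ t ∂edgeLength, P (t, 0))
    (h2 : ∀ᵐ t ∂edgeLength, P (t, 1)) (h3 : ∀ᵐ t ∂edgeLength, P (0, t))
    (h4 : ∀ᵐ t ∂edgeLength, P (1, t)) : ∀ᵐ p ∂arcLength, P p := by
  have key : ∀ f : ℝ → ℝ × ℝ, MeasurableEmbedding f → (∀ᵐ t ∂edgeLength, P (f t)) →
      ∀ᵐ p ∂edgeLength.map f, P p := fun f hf h => hf.ae_map_iff.2 h
  unfold arcLength
  simp only [ae_add_measure_iff]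
  exact ⟨⟨⟨key _ (measurableEmbedding_prod_mk_right 0) h1,
    key _ (measurableEmbedding_prod_mk_right 1) h2⟩,
    key _ (measurableEmbedding_prodMk_left 0) h3⟩, key _ (measurableEmbedding_prodMk_left 1) h4⟩

theorem ae_arcLength_mem : ∀ᵐ p ∂arcLength, p ∈ squareBoundary := by
  apply ae_arcLength <;> filter_upwards [ae_edgeLength] with t ht <;>
    simp [squareBoundary, square, ht.1, ht.2]

theorem ae_area_mem : ∀ᵐ p ∂area, p ∈ square := ae_restrict_mem measurableSet_square

theorem memLp_two_of_continuous {μ : Measure (ℝ × ℝ)} [IsFiniteMeasure μ]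
    (hμ : ∀ᵐ p ∂μ, p ∈ (Icc 0 1 : Set ℝ) ×ˢ (Icc 0 1 : Set ℝ)) {f : ℝ × ℝ → ℝ}
    (hf : Continuous f) : MemLp f 2 μ := by
  obtain ⟨C, hC⟩ := (isCompact_Icc.prod isCompact_Icc).exists_bound_of_continuousOn
    (f := f) hf.continuousOn
  exact MemLp.of_bound hf.aestronglyMeasurable C (hμ.mono fun p hp => hC p hp)

theorem memLp_area {f : ℝ × ℝ → ℝ} (hf : Continuous f) : MemLp f 2 area :=
  memLp_two_of_continuous (ae_area_mem.mono fun _ hp =>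
    prod_mono Ioo_subset_Icc_self Ioo_subset_Icc_self hp) hf

theorem memLp_arcLength {f : ℝ × ℝ → ℝ} (hf : Continuous f) : MemLp f 2 arcLength :=
  memLp_two_of_continuous (ae_arcLength_mem.mono fun _ hp => hp.1) hf

theorem integrable_area {f : ℝ × ℝ → ℝ} (hf : Continuous f) : Integrable f area :=
  (memLp_area hf).integrable (by norm_num)

theorem integral_arcLength {f : ℝ × ℝ → ℝ} (hf : Continuous f) :
    ∫ p, f p ∂arcLength = ∫ t, f (t, 0) ∂edgeLength + ∫ t, f (t, 1) ∂edgeLength +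
      ∫ t, f (0, t) ∂edgeLength + ∫ t, f (1, t) ∂edgeLength := by
  have hi : Integrable f arcLength := (memLp_arcLength hf).integrable (by norm_num)
  have h4 := hi
  unfold arcLength at h4 ⊢
  obtain ⟨h3, i4⟩ := integrable_add_measure.1 h4
  obtain ⟨h2, i3⟩ := integrable_add_measure.1 h3
  obtain ⟨i1, i2⟩ := integrable_add_measure.1 h2
  rw [integral_add_measure h3 i4, integral_add_measure h2 i3, integral_add_measure i1 i2,
    integral_map (by fun_prop) hf.aestronglyMeasurable,
    integral_map (by fun_prop) hf.aestronglyMeasurable,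
    integral_map (by fun_prop) hf.aestronglyMeasurable,
    integral_map (by fun_prop) hf.aestronglyMeasurable]

/-! ### Estimates along segments -/

theorem integral_edgeLength (f : ℝ → ℝ) : ∫ t, f t ∂edgeLength = ∫ t in (0 : ℝ)..1, f t := by
  rw [intervalIntegral.integral_of_le zero_le_one, edgeLength, integral_Icc_eq_integral_Ioc]

/-- Cauchy–Schwarz on an interval of length at most `1`, obtained by expanding `∫ (f' - A)² ≥ 0`
with `A = f t - f s`. -/
theorem sq_sub_le_integral_deriv_sq {f f' : ℝ → ℝ} (hf : ∀ t, HasDerivAt f (f' t) t)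
    (hc : Continuous f') {s t : ℝ} (hs : s ∈ Icc (0 : ℝ) 1) (ht : t ∈ Icc (0 : ℝ) 1) :
    (f t - f s) ^ 2 ≤ ∫ r, f' r ^ 2 ∂edgeLength := by
  wlog hst : s ≤ t generalizing s t
  · have := this ht hs (le_of_not_ge hst)
    linarith [show (f t - f s) ^ 2 = (f s - f t) ^ 2 by ring]
  have h1 : ∫ r in s..t, f' r = f t - f s :=
    intervalIntegral.integral_eq_sub_of_hasDerivAt (fun r _ => hf r) (hc.intervalIntegrable _ _)
  set A := f t - f s
  have h2 : 0 ≤ ∫ r in s..t, (f' r - A) ^ 2 :=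
    intervalIntegral.integral_nonneg hst fun r _ => sq_nonneg _
  have h3 : ∫ r in s..t, (f' r - A) ^ 2 = (∫ r in s..t, f' r ^ 2) - 2 * A * A + (t - s) * A ^ 2 := by
    have : ∀ r, (f' r - A) ^ 2 = f' r ^ 2 - 2 * A * f' r + A ^ 2 := fun r => by ring
    simp only [this]
    rw [intervalIntegral.integral_add, intervalIntegral.integral_sub,
      intervalIntegral.integral_const_mul, h1, intervalIntegral.integral_const, smul_eq_mul]
    all_goals exact Continuous.intervalIntegrable (by fun_prop) _ _
  have h4 : ∫ r in s..t, f' r ^ 2 ≤ ∫ r, f' r ^ 2 ∂edgeLength := by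
    rw [integral_edgeLength]
    exact intervalIntegral.integral_mono_interval hs.1 hst ht.2
      (ae_of_all _ fun r => sq_nonneg _) (Continuous.intervalIntegrable (by fun_prop) _ _)
  nlinarith [mul_nonneg (sub_nonneg.2 (show t - s ≤ 1 by linarith [hs.1, ht.2])) (sq_nonneg A)]

theorem continuous_dx {φ : ℝ × ℝ → ℝ} (hφ : ContDiff ℝ ∞ φ) : Continuous (dx φ) :=
  (hφ.continuous_fderiv (by simp)).clm_apply continuous_const

theorem continuous_dy {φ : ℝ × ℝ → ℝ} (hφ : ContDiff ℝ ∞ φ) : Continuous (dy φ) :=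
  (hφ.continuous_fderiv (by simp)).clm_apply continuous_const

theorem hasDerivAt_fst {φ : ℝ × ℝ → ℝ} (hφ : ContDiff ℝ ∞ φ) (t y : ℝ) :
    HasDerivAt (fun s => φ (s, y)) (dx φ (t, y)) t :=
  ((hφ.differentiable (by simp)) (t, y)).hasFDerivAt.comp_hasDerivAt t
    ((hasDerivAt_id t).prodMk (hasDerivAt_const t y))

theorem sq_le_of_hasDerivAt_fst {φ : ℝ × ℝ → ℝ} (hφ : ContDiff ℝ ∞ φ) {s t : ℝ}
    (hs : s ∈ Icc (0 : ℝ) 1) (ht : t ∈ Icc (0 : ℝ) 1) (y : ℝ) :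
    φ (t, y) ^ 2 ≤ 2 * φ (s, y) ^ 2 + 2 * ∫ r, dx φ (r, y) ^ 2 ∂edgeLength := by
  have := sq_sub_le_integral_deriv_sq (fun r => hasDerivAt_fst hφ r y)
    (by have := continuous_dx hφ; fun_prop) hs ht
  -- With `a = φ (t, y)` and `b = φ (s, y)`, the identity `2b² + 2(a - b)² - a² = (a - 2b)²` closes
  -- the gap.
  nlinarith [sq_nonneg (φ (t, y) - 2 * φ (s, y))]

theorem integral_area {f : ℝ × ℝ → ℝ} (hf : Continuous f) :
    ∫ p, f p ∂area = ∫ y, ∫ x, f (x, y) ∂edgeLength ∂edgeLength := by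
  have := integrable_area hf
  rw [area_eq_prod] at this ⊢
  exact integral_prod_symm _ this

theorem integrable_edge {f : ℝ → ℝ} (hf : Continuous f) : Integrable f edgeLength :=
  hf.integrableOn_Icc

theorem integrable_inner_integral {f : ℝ × ℝ → ℝ} (hf : Continuous f) :
    Integrable (fun y => ∫ x, f (x, y) ∂edgeLength) edgeLength := by
  have := integrable_area hf
  rw [area_eq_prod] at this
  exact this.integral_prod_right

/-- Each horizontal segment is entered from the left edge, and the pointwise bound is integrated in
`x` and then in `y`. -/
theorem integral_area_le_edge {φ : ℝ × ℝ → ℝ} (hφ : ContDiff ℝ ∞ φ) :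
    ∫ p, φ p ^ 2 ∂area ≤ 2 * ∫ t, φ (0, t) ^ 2 ∂edgeLength + 2 * ∫ p, dx φ p ^ 2 ∂area := by
  have hc := hφ.continuous
  have hd := continuous_dx hφ
  have i1 : Integrable (fun y => φ (0, y) ^ 2) edgeLength := integrable_edge (by fun_prop)
  have i2 := integrable_inner_integral (f := fun p => dx φ p ^ 2) (by fun_prop)
  rw [integral_area (by fun_prop), integral_area (f := fun p => dx φ p ^ 2) (by fun_prop),
    ← integral_const_mul, ← integral_const_mul,
    ← integral_add (i1.const_mul 2) (i2.const_mul 2)]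
  refine integral_mono (integrable_inner_integral (f := fun p => φ p ^ 2) (by fun_prop))
    ((i1.const_mul 2).add (i2.const_mul 2)) fun y => ?_
  refine le_trans (integral_mono_ae (integrable_edge (by fun_prop))
    (integrable_const (2 * φ (0, y) ^ 2 + 2 * ∫ r, dx φ (r, y) ^ 2 ∂edgeLength)) ?_) (by simp)
  filter_upwards [ae_edgeLength] with x hx
  exact sq_le_of_hasDerivAt_fst hφ (by simp) hx y

/-- The segment estimate bounds the value at `a` by the value at any other `x`. Averaging over `x`
replaces the latter by an area integral. -/
theorem integral_edge_le_area {φ : ℝ × ℝ → ℝ} (hφ : ContDiff ℝ ∞ φ) {a : ℝ}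
    (ha : a ∈ Icc (0 : ℝ) 1) :
    ∫ t, φ (a, t) ^ 2 ∂edgeLength ≤ 2 * ∫ p, φ p ^ 2 ∂area + 2 * ∫ p, dx φ p ^ 2 ∂area := by
  have hc := hφ.continuous
  have hd := continuous_dx hφ
  have i1 := integrable_inner_integral (f := fun p => φ p ^ 2) (by fun_prop)
  have i2 := integrable_inner_integral (f := fun p => dx φ p ^ 2) (by fun_prop)
  rw [integral_area (by fun_prop), integral_area (f := fun p => dx φ p ^ 2) (by fun_prop),
    ← integral_const_mul, ← integral_const_mul,
    ← integral_add (i1.const_mul 2) (i2.const_mul 2)]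
  refine integral_mono (integrable_edge (by fun_prop))
    ((i1.const_mul 2).add (i2.const_mul 2)) fun y => ?_
  have i3 : Integrable (fun x => 2 * φ (x, y) ^ 2) edgeLength := integrable_edge (by fun_prop)
  have : ∫ x, φ (a, y) ^ 2 ∂edgeLength ≤
      ∫ x, (2 * φ (x, y) ^ 2 + 2 * ∫ r, dx φ (r, y) ^ 2 ∂edgeLength) ∂edgeLength := by
    refine integral_mono_ae (integrable_const _) (i3.add (integrable_const _)) ?_
    filter_upwards [ae_edgeLength] with x hx
    exact sq_le_of_hasDerivAt_fst hφ hx ha y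
  rw [integral_add i3 (integrable_const _)] at this
  simpa [integral_const_mul] using this

/-! ### The two reflections -/

/-- Reflection of the square in the diagonal `y = x`. -/
def flip (p : ℝ × ℝ) : ℝ × ℝ := (p.2, p.1)

/-- Reflection of the square in the diagonal `y = 1 - x`. -/
def antiflip (p : ℝ × ℝ) : ℝ × ℝ := (1 - p.2, 1 - p.1)

theorem dx_comp_flip {φ : ℝ × ℝ → ℝ} (hφ : ContDiff ℝ ∞ φ) (p : ℝ × ℝ) :
    dx (fun p => φ (flip p)) p = dy φ (flip p) := by
  have h1 : HasFDerivAt flip ((ContinuousLinearMap.snd ℝ ℝ ℝ).prod (.fst ℝ ℝ ℝ)) p :=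
    hasFDerivAt_snd.prodMk hasFDerivAt_fst
  have := ((hφ.differentiable (by simp)) (flip p)).hasFDerivAt.comp p h1
  change fderiv ℝ (φ ∘ flip) p _ = _
  rw [this.fderiv]
  simp [dy]

theorem dy_comp_flip {φ : ℝ × ℝ → ℝ} (hφ : ContDiff ℝ ∞ φ) (p : ℝ × ℝ) :
    dy (fun p => φ (flip p)) p = dx φ (flip p) := by
  have h1 : HasFDerivAt flip ((ContinuousLinearMap.snd ℝ ℝ ℝ).prod (.fst ℝ ℝ ℝ)) p :=
    hasFDerivAt_snd.prodMk hasFDerivAt_fst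
  have := ((hφ.differentiable (by simp)) (flip p)).hasFDerivAt.comp p h1
  change fderiv ℝ (φ ∘ flip) p _ = _
  rw [this.fderiv]
  simp [dx]

theorem hasFDerivAt_antiflip (p : ℝ × ℝ) :
    HasFDerivAt antiflip ((-ContinuousLinearMap.snd ℝ ℝ ℝ).prod (-.fst ℝ ℝ ℝ)) p :=
  (hasFDerivAt_snd.const_sub 1).prodMk (hasFDerivAt_fst.const_sub 1)

theorem dx_comp_antiflip {φ : ℝ × ℝ → ℝ} (hφ : ContDiff ℝ ∞ φ) (p : ℝ × ℝ) :
    dx (fun p => φ (antiflip p)) p = -dy φ (antiflip p) := by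
  have := ((hφ.differentiable (by simp)) (antiflip p)).hasFDerivAt.comp p (hasFDerivAt_antiflip p)
  change fderiv ℝ (φ ∘ antiflip) p _ = _
  rw [this.fderiv, dy, ← map_neg]
  simp

theorem dy_comp_antiflip {φ : ℝ × ℝ → ℝ} (hφ : ContDiff ℝ ∞ φ) (p : ℝ × ℝ) :
    dy (fun p => φ (antiflip p)) p = -dx φ (antiflip p) := by
  have := ((hφ.differentiable (by simp)) (antiflip p)).hasFDerivAt.comp p (hasFDerivAt_antiflip p)
  change fderiv ℝ (φ ∘ antiflip) p _ = _
  rw [this.fderiv, dx, ← map_neg]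
  simp

theorem measurePreserving_one_sub : MeasurePreserving (fun t : ℝ => 1 - t) edgeLength edgeLength := by
  have h := (Measure.measurePreserving_sub_left (volume : Measure ℝ) 1).restrict_preimage
    (measurableSet_Icc (a := (0 : ℝ)) (b := 1))
  have h2 : (fun t : ℝ => 1 - t) ⁻¹' Icc 0 1 = Icc 0 1 := by simp
  rwa [h2] at h

theorem measurePreserving_flip_area : MeasurePreserving flip area area := by
  rw [area_eq_prod]; exact Measure.measurePreserving_swap

theorem measurePreserving_antiflip_area : MeasurePreserving antiflip area area := by
  rw [area_eq_prod]
  exact (measurePreserving_one_sub.prod measurePreserving_one_sub).comp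
    Measure.measurePreserving_swap

theorem measurable_flip : Measurable flip := measurable_snd.prodMk measurable_fst

theorem measurable_antiflip : Measurable antiflip :=
  (measurable_snd.const_sub 1).prodMk (measurable_fst.const_sub 1)

theorem measurePreserving_flip_arcLength : MeasurePreserving flip arcLength arcLength := by
  refine ⟨measurable_flip, ?_⟩
  have hm := measurable_flip
  unfold arcLength
  rw [Measure.map_add _ _ hm, Measure.map_add _ _ hm, Measure.map_add _ _ hm,
    Measure.map_map hm (by fun_prop), Measure.map_map hm (by fun_prop),
    Measure.map_map hm (by fun_prop), Measure.map_map hm (by fun_prop)]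
  simp only [Function.comp_def, flip]
  abel

theorem measurePreserving_antiflip_arcLength :
    MeasurePreserving antiflip arcLength arcLength := by
  refine ⟨measurable_antiflip, ?_⟩
  have hm := measurable_antiflip
  -- The reflection carries each edge to another one with its parameter reversed; reversal does not
  -- affect arc length.
  have key : ∀ f : ℝ → ℝ × ℝ, Measurable f →
      edgeLength.map (fun t => f (1 - t)) = edgeLength.map f := fun f hf => by
    conv_rhs => rw [← measurePreserving_one_sub.map_eq]
    rw [Measure.map_map hf (by fun_prop)]
    rfl
  unfold arcLength
  rw [Measure.map_add _ _ hm, Measure.map_add _ _ hm, Measure.map_add _ _ hm,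
    Measure.map_map hm (by fun_prop), Measure.map_map hm (by fun_prop),
    Measure.map_map hm (by fun_prop), Measure.map_map hm (by fun_prop)]
  simp only [Function.comp_def, antiflip, sub_zero, sub_self]
  rw [key (fun t => (1, t)) (by fun_prop), key (fun t => (0, t)) (by fun_prop),
    key (fun t => (t, 1)) (by fun_prop), key (fun t => (t, 0)) (by fun_prop)]
  abel

theorem contDiff_flip : ContDiff ℝ ∞ flip := contDiff_snd.prodMk contDiff_fst

theorem contDiff_antiflip : ContDiff ℝ ∞ antiflip :=
  (contDiff_const.sub contDiff_snd).prodMk (contDiff_const.sub contDiff_fst)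

theorem integral_sq_area_eq_flip {f : ℝ × ℝ → ℝ} (hf : Continuous f) :
    ∫ p, f (flip p) ^ 2 ∂area = ∫ p, f p ^ 2 ∂area := by
  conv_rhs => rw [← measurePreserving_flip_area.map_eq]
  rw [integral_map measurable_flip.aemeasurable (by fun_prop)]

/-! ### Trace and Poincaré inequalities -/

theorem integral_edge_le_area' {φ : ℝ × ℝ → ℝ} (hφ : ContDiff ℝ ∞ φ) {a : ℝ}
    (ha : a ∈ Icc (0 : ℝ) 1) :
    ∫ t, φ (t, a) ^ 2 ∂edgeLength ≤ 2 * ∫ p, φ p ^ 2 ∂area + 2 * ∫ p, dy φ p ^ 2 ∂area := by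
  have := integral_edge_le_area (hφ.comp contDiff_flip) ha
  simp only [Function.comp_def] at this
  simp only [dx_comp_flip hφ] at this
  rwa [integral_sq_area_eq_flip hφ.continuous, integral_sq_area_eq_flip (continuous_dy hφ)] at this

theorem integral_grad_sq {φ : ℝ × ℝ → ℝ} (hφ : ContDiff ℝ ∞ φ) :
    ∫ p, (dx φ p ^ 2 + dy φ p ^ 2) ∂area = ∫ p, dx φ p ^ 2 ∂area + ∫ p, dy φ p ^ 2 ∂area := by
  have h1 := continuous_dx hφ
  have h2 := continuous_dy hφ
  exact integral_add (integrable_area (by fun_prop)) (integrable_area (by fun_prop))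

/-- The trace inequality for functions that are smooth up to the boundary. -/
theorem trace_inequality {φ : ℝ × ℝ → ℝ} (hφ : ContDiff ℝ ∞ φ) :
    ∫ p, φ p ^ 2 ∂arcLength ≤
      8 * (∫ p, φ p ^ 2 ∂area + ∫ p, dx φ p ^ 2 ∂area + ∫ p, dy φ p ^ 2 ∂area) := by
  have hc := hφ.continuous
  rw [integral_arcLength (by fun_prop)]
  have h0 : (0 : ℝ) ∈ Icc (0 : ℝ) 1 := by simp
  have h1 : (1 : ℝ) ∈ Icc (0 : ℝ) 1 := by simp
  have e1 : 0 ≤ ∫ p, dx φ p ^ 2 ∂area := integral_nonneg fun _ => sq_nonneg _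
  have e2 : 0 ≤ ∫ p, dy φ p ^ 2 ∂area := integral_nonneg fun _ => sq_nonneg _
  -- Each of the four edges contributes `2 ∫ φ²`, whence the constant `8`; each partial derivative
  -- is used by two edges only.
  linarith [integral_edge_le_area hφ h0, integral_edge_le_area hφ h1,
    integral_edge_le_area' hφ h0, integral_edge_le_area' hφ h1]

/-- A Poincaré inequality with a boundary term. -/
theorem poincare_inequality {φ : ℝ × ℝ → ℝ} (hφ : ContDiff ℝ ∞ φ) :
    ∫ p, φ p ^ 2 ∂area ≤
      2 * ∫ p, φ p ^ 2 ∂arcLength + 2 * ∫ p, (dx φ p ^ 2 + dy φ p ^ 2) ∂area := by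
  have hc := hφ.continuous
  rw [integral_arcLength (by fun_prop), integral_grad_sq hφ]
  have e2 : 0 ≤ ∫ p, dy φ p ^ 2 ∂area := integral_nonneg fun _ => sq_nonneg _
  have e3 : 0 ≤ ∫ t, φ (t, 0) ^ 2 ∂edgeLength := integral_nonneg fun _ => sq_nonneg _
  have e4 : 0 ≤ ∫ t, φ (t, 1) ^ 2 ∂edgeLength := integral_nonneg fun _ => sq_nonneg _
  have e5 : 0 ≤ ∫ t, φ (1, t) ^ 2 ∂edgeLength := integral_nonneg fun _ => sq_nonneg _
  linarith [integral_area_le_edge hφ]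

section L2

variable {α : Type*} [MeasurableSpace α] {μ : Measure α}

theorem L2Tendsto.cauchy {f : ℕ → α → ℝ} {F : α → ℝ} (h : L2Tendsto μ f F) :
    Tendsto (fun n : ℕ × ℕ => ∫ p, (f n.1 p - f n.2 p) ^ 2 ∂μ) atTop (𝓝 0) := by
  have h1 := (h.tendsto_toLp.comp tendsto_fst).sub (h.tendsto_toLp.comp tendsto_snd)
  have h2 := (h1.norm).pow 2
  rw [sub_self, norm_zero, zero_pow two_ne_zero, prod_atTop_atTop_eq] at h2
  refine h2.congr fun n => ?_
  simp only [Function.comp_apply]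
  rw [← MemLp.toLp_sub, norm_toLp_sq]
  rfl

theorem L2Tendsto.mul_scalar {f : ℕ → α → ℝ} {F : α → ℝ} (h : L2Tendsto μ f F) {c : ℕ → ℝ}
    {C : ℝ} (hc : Tendsto c atTop (𝓝 C)) :
    L2Tendsto μ (fun n p => c n * f n p) (fun p => C * F p) := by
  refine ⟨fun n => (h.memLp n).const_mul _, h.memLp_lim.const_mul _, ?_⟩
  have h1 := hc.smul h.tendsto_toLp
  refine (Lp.tendsto_Lp_iff_tendsto_eLpNorm'' (fun n p => c n * f n p)
    (fun n => (h.memLp n).const_mul _) _ (h.memLp_lim.const_mul _)).1 h1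

end L2

/-! ### Test functions and weak derivatives -/

theorem IsTest.dx {φ : ℝ × ℝ → ℝ} (h : IsTest φ) : IsTest (dx φ) := by
  have hs : tsupport (WeakAnchoring.dx φ) ⊆ tsupport φ :=
    (closure_mono (fun p hp hp' => hp (by
      change fderiv ℝ φ p _ = 0; rw [hp']; rfl) :
      Function.support (WeakAnchoring.dx φ) ⊆ Function.support (fderiv ℝ φ))).trans
      (tsupport_fderiv_subset ℝ)
  exact ⟨(h.1.fderiv_right (m := ∞) (by simp)).clm_apply contDiff_const,
    h.2.1.of_isClosed_subset (isClosed_tsupport _) hs, hs.trans h.2.2⟩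

theorem IsTest.dy {φ : ℝ × ℝ → ℝ} (h : IsTest φ) : IsTest (dy φ) := by
  have hs : tsupport (WeakAnchoring.dy φ) ⊆ tsupport φ :=
    (closure_mono (fun p hp hp' => hp (by
      change fderiv ℝ φ p _ = 0; rw [hp']; rfl) :
      Function.support (WeakAnchoring.dy φ) ⊆ Function.support (fderiv ℝ φ))).trans
      (tsupport_fderiv_subset ℝ)
  exact ⟨(h.1.fderiv_right (m := ∞) (by simp)).clm_apply contDiff_const,
    h.2.1.of_isClosed_subset (isClosed_tsupport _) hs, hs.trans h.2.2⟩

/-- Nothing is known of `q` off the open square, but `φ` vanishes near every point outside its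
support, so the product is continuous everywhere. -/
theorem continuous_mul_of_tsupport_subset {q φ : ℝ × ℝ → ℝ} (hq : ContinuousOn q square)
    (hφ : Continuous φ) (hs : tsupport φ ⊆ square) : Continuous fun p => q p * φ p := by
  refine continuous_iff_continuousAt.2 fun x => ?_
  by_cases hx : x ∈ tsupport φ
  · exact (hq.continuousAt (isOpen_square.mem_nhds (hs hx))).mul hφ.continuousAt
  · have : (fun p => q p * φ p) =ᶠ[𝓝 x] fun _ => 0 := by
      filter_upwards [(isClosed_tsupport φ).isOpen_compl.mem_nhds hx] with p hp
      rw [image_eq_zero_of_notMem_tsupport hp, mul_zero]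
    exact continuousAt_const.congr this.symm

theorem IsTest.integrable_mul {q φ : ℝ × ℝ → ℝ} (hφ : IsTest φ) (hq : ContinuousOn q square) :
    Integrable fun p => q p * φ p :=
  (continuous_mul_of_tsupport_subset hq hφ.1.continuous hφ.2.2).integrable_of_hasCompactSupport
    hφ.2.1.mul_left

theorem IsTest.integral_area {φ : ℝ × ℝ → ℝ} (hφ : IsTest φ) (q : ℝ × ℝ → ℝ) :
    ∫ p, q p * φ p ∂area = ∫ p, q p * φ p :=
  setIntegral_eq_integral_of_forall_compl_eq_zero fun p hp => by
    rw [image_eq_zero_of_notMem_tsupport fun h => hp (hφ.2.2 h), mul_zero]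

theorem continuousOn_fderiv_square {q : ℝ × ℝ → ℝ} (hq : ContDiffOn ℝ ∞ q square) :
    ContinuousOn (fderiv ℝ q) square :=
  hq.continuousOn_fderiv_of_isOpen isOpen_square (by simp)

theorem continuousOn_dx {q : ℝ × ℝ → ℝ} (hq : ContDiffOn ℝ ∞ q square) :
    ContinuousOn (dx q) square :=
  (continuousOn_fderiv_square hq).clm_apply continuousOn_const

theorem continuousOn_dy {q : ℝ × ℝ → ℝ} (hq : ContDiffOn ℝ ∞ q square) :
    ContinuousOn (dy q) square :=
  (continuousOn_fderiv_square hq).clm_apply continuousOn_const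

theorem differentiableAt_square {q : ℝ × ℝ → ℝ} (hq : ContDiffOn ℝ ∞ q square) {p : ℝ × ℝ}
    (hp : p ∈ square) : DifferentiableAt ℝ q p :=
  (hq.contDiffAt (isOpen_square.mem_nhds hp)).differentiableAt (by simp)

theorem integral_mul_dx {q φ : ℝ × ℝ → ℝ} (hq : ContDiffOn ℝ ∞ q square) (hφ : IsTest φ) :
    ∫ p, q p * dx φ p ∂area = -∫ p, dx q p * φ p ∂area := by
  rw [hφ.integral_area, hφ.dx.integral_area]
  exact integral_mul_fderiv_eq_neg_fderiv_mul_of_integrable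
    (hφ.integrable_mul (continuousOn_dx hq)) (hφ.dx.integrable_mul hq.continuousOn)
    (hφ.integrable_mul hq.continuousOn) (fun p hp => differentiableAt_square hq (hφ.2.2 hp))
    (fun p _ => (hφ.1.differentiable (by simp)) p)

theorem integral_mul_dy {q φ : ℝ × ℝ → ℝ} (hq : ContDiffOn ℝ ∞ q square) (hφ : IsTest φ) :
    ∫ p, q p * dy φ p ∂area = -∫ p, dy q p * φ p ∂area := by
  rw [hφ.integral_area, hφ.dy.integral_area]
  exact integral_mul_fderiv_eq_neg_fderiv_mul_of_integrable
    (hφ.integrable_mul (continuousOn_dy hq)) (hφ.dy.integrable_mul hq.continuousOn)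
    (hφ.integrable_mul hq.continuousOn) (fun p hp => differentiableAt_square hq (hφ.2.2 hp))
    (fun p _ => (hφ.1.differentiable (by simp)) p)

theorem memLp_test {φ : ℝ × ℝ → ℝ} (hφ : IsTest φ) : MemLp φ 2 area := memLp_area hφ.1.continuous

/-- The fundamental lemma of the calculus of variations on the square. -/
theorem ae_eq_of_forall_isTest {w v : ℝ × ℝ → ℝ} (hw : MemLp w 2 area)
    (hv : ContinuousOn v square)
    (h : ∀ φ, IsTest φ → ∫ p, w p * φ p ∂area = ∫ p, v p * φ p ∂area) : w =ᵐ[area] v := by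
  have hwi : IntegrableOn w square := hw.integrable (by norm_num)
  have hl : LocallyIntegrableOn (fun p => w p - v p) square :=
    hwi.locallyIntegrableOn.sub (hv.locallyIntegrableOn measurableSet_square)
  have key := isOpen_square.ae_eq_zero_of_integral_contDiff_smul_eq_zero hl fun φ h1 h2 h3 => by
    have hφ : IsTest φ := ⟨h1, h2, h3⟩
    have e := hφ.integral_area fun p => w p - v p
    simp only [smul_eq_mul, mul_comm (φ _)]
    rw [← e]
    simp only [sub_mul]
    have hi : Integrable (fun p => w p * φ p) area := hw.integrable_mul (memLp_test hφ)
    rw [integral_sub hi (hφ.integrable_mul hv).integrableOn,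
      h φ hφ, sub_self]
  refine (ae_restrict_iff' measurableSet_square).2 ?_
  filter_upwards [key] with p hp hps
  exact sub_eq_zero.1 (hp hps)

theorem MemW12.of_contDiffOn {q : ℝ × ℝ → ℝ} (hq : ContDiffOn ℝ ∞ q square) (h0 : MemLp q 2 area)
    (h1 : MemLp (dx q) 2 area) (h2 : MemLp (dy q) 2 area) : MemW12 q :=
  ⟨h0, dx q, dy q, h1, h2, fun _ hφ => ⟨integral_mul_dx hq hφ, integral_mul_dy hq hφ⟩⟩

/-- Weak derivatives of a function that is smooth in the square are the classical ones. -/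
theorem ae_eq_dx {q w : ℝ × ℝ → ℝ} (hq : ContDiffOn ℝ ∞ q square) (hw : MemLp w 2 area)
    (h : ∀ φ, IsTest φ → ∫ p, q p * dx φ p ∂area = -∫ p, w p * φ p ∂area) : w =ᵐ[area] dx q :=
  ae_eq_of_forall_isTest hw (continuousOn_dx hq) fun φ hφ => by
    linarith [h φ hφ, integral_mul_dx hq hφ]

theorem ae_eq_dy {q w : ℝ × ℝ → ℝ} (hq : ContDiffOn ℝ ∞ q square) (hw : MemLp w 2 area)
    (h : ∀ φ, IsTest φ → ∫ p, q p * dy φ p ∂area = -∫ p, w p * φ p ∂area) : w =ᵐ[area] dy q :=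
  ae_eq_of_forall_isTest hw (continuousOn_dy hq) fun φ hφ => by
    linarith [h φ hφ, integral_mul_dy hq hφ]

/-- Membership in `W^{1,2}` only supplies some weak derivative in `L²`; the fundamental lemma
identifies it with the classical one. -/
theorem Admissible.memLp_dx {q : ℝ × ℝ → ℝ} (h : Admissible q) : MemLp (dx q) 2 area := by
  obtain ⟨hq, -, w₁, w₂, h1, -, hw⟩ := h
  exact (memLp_congr_ae (ae_eq_dx hq h1 fun φ hφ => (hw φ hφ).1)).1 h1

theorem Admissible.memLp_dy {q : ℝ × ℝ → ℝ} (h : Admissible q) : MemLp (dy q) 2 area := by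
  obtain ⟨hq, -, w₁, w₂, -, h2, hw⟩ := h
  exact (memLp_congr_ae (ae_eq_dy hq h2 fun φ hφ => (hw φ hφ).2)).1 h2

theorem admissible_of_contDiff {φ : ℝ × ℝ → ℝ} (h : ContDiff ℝ ∞ φ) : Admissible φ :=
  ⟨h.contDiffOn, .of_contDiffOn h.contDiffOn (memLp_area h.continuous)
    (memLp_area (continuous_dx h)) (memLp_area (continuous_dy h))⟩

/-! ### Dilations in `L²` -/

section Dilation

variable {E : Type*} [NormedAddCommGroup E] [NormedSpace ℝ E]

/-- The homothety with centre `c` and ratio `r`. -/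
def dilate (c : E) (r : ℝ) (p : E) : E := c + r • (p - c)

theorem continuous_dilate (c : E) (r : ℝ) : Continuous (dilate c r) := by
  unfold dilate; fun_prop

theorem dilate_sub (c : E) (r : ℝ) (p : E) : dilate c r p - c = r • (p - c) := by simp [dilate]

variable [MeasurableSpace E] [BorelSpace E] [FiniteDimensional ℝ E] {μ : Measure E}
  [μ.IsAddHaarMeasure]

theorem map_dilate (c : E) {r : ℝ} (hr : r ≠ 0) :
    μ.map (dilate c r) = ENNReal.ofReal |(r ^ Module.finrank ℝ E)⁻¹| • μ := by
  have h : dilate c r = (fun p => c + p) ∘ (fun p => r • p) ∘ fun p => p - c := rfl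
  have m1 : Measurable fun p : E => c + p := by fun_prop
  have m2 : Measurable fun p : E => r • p := by fun_prop
  have m3 : Measurable fun p : E => p - c := by fun_prop
  rw [h, ← Measure.map_map m1 (m2.comp m3), ← Measure.map_map m2 m3,
    (measurePreserving_sub_right μ c).map_eq, Measure.map_addHaar_smul μ hr,
    Measure.map_smul, (measurePreserving_add_left μ c).map_eq]

/-- Change of variables gives the factor `r ^ (-dim / 2)`. The cruder `2 ^ dim` suffices, since only
uniformity in `r ≥ 1 / 2` matters. -/
theorem eLpNorm_comp_dilate_le (c : E) {r : ℝ} (hr : 1 / 2 ≤ r) {f : E → ℝ}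
    (hf : AEStronglyMeasurable f μ) :
    eLpNorm (fun p => f (dilate c r p)) 2 μ ≤ 2 ^ Module.finrank ℝ E * eLpNorm f 2 μ := by
  have hr0 : 0 < r := by linarith
  set K := ENNReal.ofReal |(r ^ Module.finrank ℝ E)⁻¹| with hK
  have hK1 : K ≤ 2 ^ Module.finrank ℝ E := by
    have : |(r ^ Module.finrank ℝ E)⁻¹| ≤ 2 ^ Module.finrank ℝ E := by
      rw [abs_of_pos (by positivity), ← inv_pow]
      refine pow_le_pow_left₀ (by positivity) ?_ _
      rw [inv_le_comm₀ hr0 two_pos]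
      linarith
    refine (ENNReal.ofReal_le_ofReal this).trans ?_
    rw [ENNReal.ofReal_pow (by norm_num)]
    simp
  have hm := map_dilate (μ := μ) c hr0.ne'
  have hf' : AEStronglyMeasurable f (μ.map (dilate c r)) := by
    rw [hm]; exact hf.smul_measure _
  have e := eLpNorm_map_measure (p := 2) hf' (continuous_dilate c r).measurable.aemeasurable
  change eLpNorm (f ∘ dilate c r) 2 μ ≤ _
  rw [← e, hm, eLpNorm_smul_measure_of_ne_top (by norm_num), smul_eq_mul]
  gcongr
  have h1 : (1 : ENNReal) ≤ 2 ^ Module.finrank ℝ E := one_le_pow₀ (by norm_num)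
  refine (ENNReal.rpow_le_rpow hK1 (by positivity)).trans ?_
  conv_rhs => rw [← ENNReal.rpow_one (2 ^ Module.finrank ℝ E)]
  exact ENNReal.rpow_le_rpow_of_exponent_le h1 (by norm_num)

theorem tendsto_eLpNorm_dilate_of_continuous (c : E) {r : ℕ → ℝ} (hr : ∀ n, 1 / 2 ≤ r n)
    (hr1 : Tendsto r atTop (𝓝 1)) {g : E → ℝ} (hg : Continuous g) (hs : HasCompactSupport g) :
    Tendsto (fun n => eLpNorm (fun p => g (dilate c (r n) p) - g p) 2 μ) atTop (𝓝 0) := by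
  obtain ⟨M, hM⟩ := hs.exists_bound_of_continuous hg
  obtain ⟨R, hR⟩ := hs.isCompact.isBounded.subset_closedBall c
  have hz : ∀ p, p ∉ Metric.closedBall c R → g p = 0 := fun p hp =>
    image_eq_zero_of_notMem_tsupport fun h => hp (hR h)
  -- Since `r n ≥ 1 / 2`, a point farther than `2 |R|` from `c` stays farther than `|R|` after
  -- dilation, so both terms vanish. This gives one integrable majorant for all `n`.
  have hz2 : ∀ n p, p ∉ Metric.closedBall c (2 * |R|) → g (dilate c (r n) p) - g p = 0 := by
    intro n p hp
    rw [Metric.mem_closedBall, dist_eq_norm, not_le] at hp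
    have h2 := le_abs_self R
    have h3 := abs_nonneg R
    rw [hz p, hz, sub_zero]
    · rw [Metric.mem_closedBall, dist_eq_norm, dilate_sub, norm_smul, not_le, Real.norm_eq_abs,
        abs_of_nonneg (by linarith [hr n])]
      nlinarith [hr n, norm_nonneg (p - c)]
    · rw [Metric.mem_closedBall, dist_eq_norm, not_le]
      linarith
  have hcont : ∀ n, Continuous fun p => g (dilate c (r n) p) - g p := fun n =>
    (hg.comp (continuous_dilate c (r n))).sub hg
  have hcs : ∀ n, HasCompactSupport fun p => g (dilate c (r n) p) - g p := fun n =>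
    HasCompactSupport.intro (isCompact_closedBall c (2 * |R|)) (hz2 n)
  refine (tendsto_eLpNorm_iff_integral_sq fun n =>
    (hcont n).memLp_of_hasCompactSupport (hcs n)).2 ?_
  have key := tendsto_integral_of_dominated_convergence (μ := μ)
    (F := fun n p => (g (dilate c (r n) p) - g p) ^ 2) (f := fun _ => 0)
    (indicator (Metric.closedBall c (2 * |R|)) fun _ => (2 * M) ^ 2)
    (fun n => ((hcont n).pow 2).aestronglyMeasurable)
    ((integrable_indicator_iff measurableSet_closedBall).2
      (integrableOn_const (measure_closedBall_lt_top.ne))) ?_ ?_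
  · simpa using key
  · refine fun n => ae_of_all _ fun p => ?_
    by_cases hp : p ∈ Metric.closedBall c (2 * |R|)
    · rw [indicator_of_mem hp, Real.norm_eq_abs, abs_pow]
      refine pow_le_pow_left₀ (abs_nonneg _) ?_ 2
      have := norm_sub_le (g (dilate c (r n) p)) (g p)
      rw [Real.norm_eq_abs] at this
      linarith [hM (dilate c (r n) p), hM p]
    · rw [indicator_of_notMem hp, hz2 n p hp]
      simp
  · refine ae_of_all _ fun p => ?_
    have h1 : Tendsto (fun n => dilate c (r n) p) atTop (𝓝 p) := by
      have := (hr1.smul_const (p - c)).const_add c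
      simpa [dilate] using this
    have h2 := ((hg.tendsto p).comp h1).sub_const (g p)
    rw [sub_self] at h2
    simpa using h2.pow 2

/-- Continuity of dilations in `L²`. -/
theorem tendsto_eLpNorm_dilate (c : E) {r : ℕ → ℝ} (hr : ∀ n, 1 / 2 ≤ r n)
    (hr1 : Tendsto r atTop (𝓝 1)) {f : E → ℝ} (hf : MemLp f 2 μ) :
    Tendsto (fun n => eLpNorm (fun p => f (dilate c (r n) p) - f p) 2 μ) atTop (𝓝 0) := by
  refine ENNReal.tendsto_nhds_zero.2 fun ε hε => ?_
  set K : ENNReal := 2 ^ Module.finrank ℝ E with hK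
  have hK0 : K ≠ ⊤ := ENNReal.pow_ne_top (by norm_num)
  have hK1 : 1 ≤ K := one_le_pow₀ (by norm_num)
  -- The factor `K` in the tolerance pays for the loss when the error `f - g` is composed with the
  -- dilation.
  obtain ⟨g, gs, gf, gc, gm⟩ := hf.exists_hasCompactSupport_eLpNorm_sub_le (by norm_num)
    (ε := ε / (3 * K)) (ENNReal.div_ne_zero.2 ⟨hε.ne', ENNReal.mul_ne_top (by norm_num) hK0⟩)
  have hK3 : K * (ε / (3 * K)) = ε / 3 := by
    rw [mul_comm 3 K, ← mul_div_assoc, ENNReal.mul_div_mul_left _ _ (by positivity) hK0]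
  have ev := ENNReal.tendsto_nhds_zero.1
    (tendsto_eLpNorm_dilate_of_continuous (μ := μ) c hr hr1 gc gs) (ε / 3)
    (ENNReal.div_pos hε.ne' (by norm_num))
  filter_upwards [ev] with n hn
  have m1 : AEStronglyMeasurable (f - g) μ := hf.1.sub gm.1
  have h1 := eLpNorm_comp_dilate_le (μ := μ) c (hr n) m1
  have h2 : eLpNorm (fun p => (f - g) (dilate c (r n) p)) 2 μ ≤ ε / 3 := by
    refine h1.trans ?_
    rw [← hK3]
    gcongr
  have h3 : eLpNorm (f - g) 2 μ ≤ ε / 3 := by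
    refine gf.trans ?_
    rw [← hK3]
    exact le_mul_of_one_le_left bot_le hK1
  have m2 : AEStronglyMeasurable (fun p => (f - g) (dilate c (r n) p)) μ := by
    refine AEStronglyMeasurable.comp_aemeasurable (f := dilate c (r n)) ?_
      (continuous_dilate c (r n)).measurable.aemeasurable
    rw [map_dilate c (by linarith [hr n])]
    exact m1.smul_measure _
  have m3 : AEStronglyMeasurable (fun p => g (dilate c (r n) p) - g p) μ :=
    ((gc.comp (continuous_dilate c (r n))).sub gc).aestronglyMeasurable
  have e : (fun p => f (dilate c (r n) p) - f p) =
      ((fun p => (f - g) (dilate c (r n) p)) + fun p => g (dilate c (r n) p) - g p) - (f - g) := by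
    ext p
    simp only [Pi.add_apply, Pi.sub_apply]
    ring
  rw [e]
  refine (eLpNorm_sub_le (m2.add m3) m1 (by norm_num)).trans ?_
  refine (add_le_add (eLpNorm_add_le m2 m3 (by norm_num)) le_rfl).trans ?_
  refine (add_le_add (add_le_add h2 hn) h3).trans (le_of_eq ?_)
  exact ENNReal.add_thirds ε

end Dilation

theorem square_eq_ball : square = Metric.ball ((1 / 2, 1 / 2) : ℝ × ℝ) (1 / 2) := by
  rw [← ball_prod_same, Real.ball_eq_Ioo, square]
  norm_num

theorem dilate_mem_square {r : ℝ} (hr0 : 0 ≤ r) {R : ℝ} {p : ℝ × ℝ}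
    (hp : p ∈ Metric.closedBall ((1 / 2, 1 / 2) : ℝ × ℝ) R) (hR : r * R < 1 / 2) :
    dilate (1 / 2, 1 / 2) r p ∈ square := by
  rw [Metric.mem_closedBall, dist_eq_norm] at hp
  rw [square_eq_ball, Metric.mem_ball, dist_eq_norm, dilate_sub, norm_smul, Real.norm_eq_abs,
    abs_of_nonneg hr0]
  nlinarith

/-- The result on the whole plane is applied to the extension of `f` by zero. For ratios below `1`
the square is mapped into itself, so on the square the extension is never felt. -/
theorem L2Tendsto.dilate {f : ℝ × ℝ → ℝ} (hf : MemLp f 2 area) {r : ℕ → ℝ}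
    (hr : ∀ n, 1 / 2 ≤ r n) (hr1 : ∀ n, r n < 1) (hr2 : Tendsto r atTop (𝓝 1)) :
    L2Tendsto area (fun n p => f (dilate (1 / 2, 1 / 2) (r n) p)) f := by
  have hF : MemLp (square.indicator f) 2 volume := (memLp_indicator_iff_restrict
    measurableSet_square).2 hf
  have h1 := tendsto_eLpNorm_dilate (μ := volume) ((1 / 2, 1 / 2) : ℝ × ℝ) hr hr2 hF
  have hmem : ∀ n p, p ∈ square → WeakAnchoring.dilate (1 / 2, 1 / 2) (r n) p ∈ square :=
    fun n p hp => dilate_mem_square (R := 1 / 2) (by linarith [hr n])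
      (Metric.ball_subset_closedBall (square_eq_ball ▸ hp)) (by linarith [hr1 n])
  have h2 : ∀ n, MemLp (fun p => square.indicator f
      (WeakAnchoring.dilate (1 / 2, 1 / 2) (r n) p)) 2 (volume : Measure (ℝ × ℝ)) := fun n => by
    refine ⟨?_, (eLpNorm_comp_dilate_le _ (hr n) hF.1).trans_lt
      (ENNReal.mul_lt_top (ENNReal.pow_lt_top (by norm_num)) hF.2)⟩
    refine AEStronglyMeasurable.comp_aemeasurable (g := square.indicator f)
      (f := WeakAnchoring.dilate ((1 / 2, 1 / 2) : ℝ × ℝ) (r n)) ?_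
      (continuous_dilate _ (r n)).measurable.aemeasurable
    rw [map_dilate _ (by linarith [hr n])]
    exact hF.1.smul_measure _
  have e1 : ∀ n, (fun p => square.indicator f (WeakAnchoring.dilate (1 / 2, 1 / 2) (r n) p))
      =ᵐ[area] fun p => f (WeakAnchoring.dilate (1 / 2, 1 / 2) (r n) p) := fun n => by
    filter_upwards [ae_area_mem] with p hp
    rw [indicator_of_mem (hmem n p hp)]
  refine ⟨fun n => (memLp_congr_ae (e1 n)).1 ((h2 n).mono_measure Measure.restrict_le_self), hf, ?_⟩
  refine tendsto_of_tendsto_of_tendsto_of_le_of_le tendsto_const_nhds h1 (fun n => bot_le)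
    fun n => ?_
  refine le_trans (le_of_eq (eLpNorm_congr_ae ?_)) (eLpNorm_mono_measure _
    (Measure.restrict_le_self (s := square)))
  filter_upwards [e1 n, ae_area_mem] with p h3 h4
  rw [h3, indicator_of_mem h4]

/-! ### Density of smooth functions and the trace theorem -/

/-- `φ` is a sequence of functions, smooth up to the boundary, that exhibits `t` as the trace of
`q`. -/
structure Approximates (φ : ℕ → ℝ × ℝ → ℝ) (q t : ℝ × ℝ → ℝ) : Prop where
  contDiff : ∀ n, ContDiff ℝ ∞ (φ n)
  val : L2Tendsto area φ q
  dx : L2Tendsto area (fun n => dx (φ n)) (dx q)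
  dy : L2Tendsto area (fun n => dy (φ n)) (dy q)
  bdry : L2Tendsto arcLength φ t

theorem Approximates.isTrace {φ : ℕ → ℝ × ℝ → ℝ} {q t : ℝ × ℝ → ℝ} (h : Approximates φ q t) :
    IsTrace q t :=
  ⟨h.bdry.memLp_lim, φ, h.contDiff, h.val.tendsto, h.dx.tendsto, h.dy.tendsto, h.bdry.tendsto⟩

theorem IsTrace.exists_approximates {q t : ℝ × ℝ → ℝ} (h : IsTrace q t) (hq : Admissible q) :
    ∃ φ, Approximates φ q t := by
  obtain ⟨ht, φ, h0, h1, h2, h3, h4⟩ := h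
  exact ⟨φ, h0, ⟨fun n => memLp_area (h0 n).continuous, hq.2.1, h1⟩,
    ⟨fun n => memLp_area (continuous_dx (h0 n)), hq.memLp_dx, h2⟩,
    ⟨fun n => memLp_area (continuous_dy (h0 n)), hq.memLp_dy, h3⟩,
    ⟨fun n => memLp_arcLength (h0 n).continuous, ht, h4⟩⟩

theorem dx_sub {φ ψ : ℝ × ℝ → ℝ} (hφ : ContDiff ℝ ∞ φ) (hψ : ContDiff ℝ ∞ ψ) (p : ℝ × ℝ) :
    dx (fun p => φ p - ψ p) p = dx φ p - dx ψ p := by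
  unfold dx
  rw [fderiv_fun_sub (hφ.differentiable (by simp) p) (hψ.differentiable (by simp) p)]
  rfl

theorem dy_sub {φ ψ : ℝ × ℝ → ℝ} (hφ : ContDiff ℝ ∞ φ) (hψ : ContDiff ℝ ∞ ψ) (p : ℝ × ℝ) :
    dy (fun p => φ p - ψ p) p = dy φ p - dy ψ p := by
  unfold dy
  rw [fderiv_fun_sub (hφ.differentiable (by simp) p) (hψ.differentiable (by simp) p)]
  rfl

theorem integral_arcLength_sub_sq_le {φ ψ : ℝ × ℝ → ℝ} (hφ : ContDiff ℝ ∞ φ)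
    (hψ : ContDiff ℝ ∞ ψ) :
    ∫ p, (φ p - ψ p) ^ 2 ∂arcLength ≤ 8 * (∫ p, (φ p - ψ p) ^ 2 ∂area +
      ∫ p, (dx φ p - dx ψ p) ^ 2 ∂area + ∫ p, (dy φ p - dy ψ p) ^ 2 ∂area) := by
  have := trace_inequality (hφ.sub hψ)
  simpa only [dx_sub hφ hψ, dy_sub hφ hψ] using this

/-- The trace inequality, applied to the difference of two approximating sequences with the same
`W^{1,2}` limit. -/
theorem IsTrace.ae_eq {q t t' : ℝ × ℝ → ℝ} (hq : Admissible q) (h : IsTrace q t)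
    (h' : IsTrace q t') : t =ᵐ[arcLength] t' := by
  obtain ⟨φ, hφ⟩ := h.exists_approximates hq
  obtain ⟨ψ, hψ⟩ := h'.exists_approximates hq
  refine hφ.bdry.ae_eq hψ.bdry ?_
  have h0 := (((hφ.val.sub hψ.val).integral_sq.add (hφ.dx.sub hψ.dx).integral_sq).add
    (hφ.dy.sub hψ.dy).integral_sq).const_mul 8
  simp only [sub_self, ne_eq, OfNat.ofNat_ne_zero, not_false_eq_true, zero_pow, integral_zero,
    add_zero, mul_zero] at h0
  exact tendsto_of_tendsto_of_tendsto_of_le_of_le tendsto_const_nhds h0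
    (fun n => integral_nonneg fun p => sq_nonneg _)
    (fun n => integral_arcLength_sub_sq_le (hφ.contDiff n) (hψ.contDiff n))

/-- Functions smooth up to the boundary are dense in the admissible class. -/
theorem Admissible.exists_contDiff_tendsto {q : ℝ × ℝ → ℝ} (hq : Admissible q) :
    ∃ φ : ℕ → ℝ × ℝ → ℝ, (∀ n, ContDiff ℝ ∞ (φ n)) ∧ L2Tendsto area φ q ∧
      L2Tendsto area (fun n => dx (φ n)) (dx q) ∧ L2Tendsto area (fun n => dy (φ n)) (dy q) := by
  let r : ℕ → ℝ := fun n => 1 - 1 / ((n : ℝ) + 2)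
  have hpos : ∀ n : ℕ, 0 < 1 / ((n : ℝ) + 2) := fun n => by positivity
  have hle : ∀ n : ℕ, 1 / ((n : ℝ) + 2) ≤ 1 / 2 := fun n =>
    one_div_le_one_div_of_le two_pos (by linarith [n.cast_nonneg (α := ℝ)])
  have hr : ∀ n, 1 / 2 ≤ r n := fun n => by simp only [r]; linarith [hle n]
  have hr1 : ∀ n, r n < 1 := fun n => by simp only [r]; linarith [hpos n]
  have hr2 : Tendsto r atTop (𝓝 1) := by
    have h1 : Tendsto (fun n : ℕ => 1 / ((n : ℝ) + 2)) atTop (𝓝 0) := by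
      have := (tendsto_const_nhds (x := (1 : ℝ))).div_atTop
        (tendsto_atTop_add_const_right _ (2 : ℝ) (tendsto_natCast_atTop_atTop (R := ℝ)))
      exact this
    simpa [r] using h1.const_sub 1
  let c : ℝ × ℝ := (1 / 2, 1 / 2)
  -- With `ε = 1 / (n + 2)` one has `r n * R n = (1 - ε²) / 2 < 1 / 2`: the cut-off equals `1` on
  -- the square, and its whole support is dilated into the open square, where `q` is smooth.
  let R : ℕ → ℝ := fun n => 1 / 2 * (1 + 1 / ((n : ℝ) + 2))
  let χ : ∀ n : ℕ, ContDiffBump c := fun n =>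
    ⟨1 / 2, R n, by norm_num, by simp only [R]; linarith [hpos n]⟩
  have hrR : ∀ n, r n * R n < 1 / 2 := fun n => by
    simp only [r, R]
    nlinarith [hpos n, mul_pos (hpos n) (hpos n)]
  let φ : ℕ → ℝ × ℝ → ℝ := fun n p => χ n p * q (dilate c (r n) p)
  have hdil : ∀ n, ContDiff ℝ ∞ (dilate c (r n)) := fun n => by
    unfold dilate; fun_prop
  have hφ : ∀ n, ContDiff ℝ ∞ (φ n) := fun n => by
    refine contDiff_iff_contDiffAt.2 fun x => ?_
    by_cases hx : x ∈ Metric.closedBall c (R n)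
    · have hm : dilate c (r n) x ∈ square := dilate_mem_square (by linarith [hr n]) hx (hrR n)
      exact (χ n).contDiff.contDiffAt.mul
        (ContDiffAt.comp x (hq.1.contDiffAt (isOpen_square.mem_nhds hm)) (hdil n).contDiffAt)
    · have : φ n =ᶠ[𝓝 x] fun _ => 0 := by
        filter_upwards [Metric.isClosed_closedBall.isOpen_compl.mem_nhds hx] with p hp
        have : χ n p = 0 := image_eq_zero_of_notMem_tsupport (by rwa [(χ n).tsupport_eq])
        simp only [φ, this, zero_mul]
      exact contDiffAt_const.congr_of_eventuallyEq this
  have hmem : ∀ n p, p ∈ square → dilate c (r n) p ∈ square :=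
    fun n p hp => dilate_mem_square (R := 1 / 2) (by linarith [hr n])
      (Metric.ball_subset_closedBall (square_eq_ball ▸ hp)) (by linarith [hr1 n])
  have heq : ∀ n p, p ∈ square → φ n p = q (dilate c (r n) p) := fun n p hp => by
    have : χ n p = 1 := (χ n).one_of_mem_closedBall
      (Metric.ball_subset_closedBall (square_eq_ball ▸ hp))
    simp only [φ, this, one_mul]
  have hder : ∀ n p, p ∈ square → HasFDerivAt (φ n) (r n • fderiv ℝ q (dilate c (r n) p)) p := by
    intro n p hp
    have h1 : HasFDerivAt (dilate c (r n)) (r n • ContinuousLinearMap.id ℝ (ℝ × ℝ)) p :=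
      (((hasFDerivAt_id p).sub_const c).const_smul (r n)).const_add c
    have h2 := (differentiableAt_square hq.1 (hmem n p hp)).hasFDerivAt.comp p h1
    have h3 : φ n =ᶠ[𝓝 p] q ∘ dilate c (r n) := by
      filter_upwards [isOpen_square.mem_nhds hp] with x hx using heq n x hx
    refine (h2.congr_of_eventuallyEq h3).congr_fderiv ?_
    ext <;> simp
  -- The factor `s n` is `1` for the function itself and `r n` for its derivatives, by the chain
  -- rule.
  have hlim : ∀ f : ℝ × ℝ → ℝ, MemLp f 2 area → ∀ ψ : ℕ → ℝ × ℝ → ℝ, (∀ n, MemLp (ψ n) 2 area) →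
      ∀ s : ℕ → ℝ, Tendsto s atTop (𝓝 1) →
      (∀ n p, p ∈ square → ψ n p = s n * f (dilate c (r n) p)) → L2Tendsto area ψ f := by
    intro f hf ψ hψ s hs h
    have h1 := (L2Tendsto.dilate hf hr hr1 hr2).mul_scalar hs
    simp only [one_mul] at h1
    refine ⟨hψ, hf, h1.tendsto.congr fun n => eLpNorm_congr_ae ?_⟩
    filter_upwards [ae_area_mem] with p hp
    rw [h n p hp]
  refine ⟨φ, hφ, ?_, ?_, ?_⟩
  · exact hlim q hq.2.1 φ (fun n => memLp_area (hφ n).continuous) (fun _ => 1)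
      tendsto_const_nhds fun n p hp => by rw [heq n p hp, one_mul]
  · refine hlim _ hq.memLp_dx _ (fun n => memLp_area (continuous_dx (hφ n))) r hr2
      fun n p hp => ?_
    rw [dx, (hder n p hp).fderiv]
    rfl
  · refine hlim _ hq.memLp_dy _ (fun n => memLp_area (continuous_dy (hφ n))) r hr2
      fun n p hp => ?_
    rw [dy, (hder n p hp).fderiv]
    rfl

/-- The trace theorem: every admissible function has a trace. -/
theorem Admissible.isTrace_trace {q : ℝ × ℝ → ℝ} (hq : Admissible q) : IsTrace q (trace q) := by
  obtain ⟨φ, h0, h1, h2, h3⟩ := hq.exists_contDiff_tendsto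
  -- By the trace inequality, a Cauchy sequence in `W^{1,2}` has boundary values that are Cauchy in
  -- `L²` of the boundary.
  have hb := ((h1.cauchy.add h2.cauchy).add h3.cauchy).const_mul 8
  simp only [add_zero, mul_zero] at hb
  obtain ⟨t, ht⟩ := exists_L2Tendsto (fun n => memLp_arcLength (h0 n).continuous)
    (tendsto_of_tendsto_of_tendsto_of_le_of_le tendsto_const_nhds hb
      (fun n => integral_nonneg fun p => sq_nonneg _)
      (fun n => integral_arcLength_sub_sq_le (h0 n.1) (h0 n.2)))
  have h : ∃ t, IsTrace q t := ⟨t, (Approximates.mk h0 h1 h2 h3 ht).isTrace⟩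
  rw [trace, dif_pos h]
  exact h.choose_spec

theorem IsTrace.trace_ae_eq {q t : ℝ × ℝ → ℝ} (hq : Admissible q) (h : IsTrace q t) :
    trace q =ᵐ[arcLength] t := hq.isTrace_trace.ae_eq hq h

theorem trace_ae_eq_of_contDiff {φ : ℝ × ℝ → ℝ} (h : ContDiff ℝ ∞ φ) :
    trace φ =ᵐ[arcLength] φ :=
  IsTrace.trace_ae_eq (admissible_of_contDiff h) (Approximates.isTrace (φ := fun _ => φ)
    ⟨fun _ => h, .const (memLp_area h.continuous), .const (memLp_area (continuous_dx h)),
      .const (memLp_area (continuous_dy h)), .const (memLp_arcLength h.continuous)⟩)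

/-! ### Weyl's lemma -/

/-- A smooth nondecreasing step from `0` (for `s ≤ 1 / 2`) to `1` (for `s ≥ 1`). -/
def step (s : ℝ) : ℝ := Real.smoothTransition (2 * s - 1)

theorem contDiff_step : ContDiff ℝ ∞ step :=
  Real.smoothTransition.contDiff.comp (by fun_prop)

theorem step_eq_zero {s : ℝ} (h : s ≤ 1 / 2) : step s = 0 :=
  Real.smoothTransition.zero_of_nonpos (by linarith)

theorem step_eq_one {s : ℝ} (h : 1 ≤ s) : step s = 1 :=
  Real.smoothTransition.one_of_one_le (by linarith)

theorem monotone_step : Monotone step := fun a b h =>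
  Real.smoothTransition.monotone (by linarith)

theorem contDiff_deriv_step : ContDiff ℝ ∞ (deriv step) := (contDiff_infty_iff_deriv.1 contDiff_step).2

theorem deriv_step_eq_zero {s : ℝ} (h : 1 < s) : deriv step s = 0 := by
  have : step =ᶠ[𝓝 s] fun _ => 1 := by
    filter_upwards [lt_mem_nhds h] with t ht using step_eq_one ht.le
  rw [this.deriv_eq, deriv_const]

/-- The squared Euclidean norm. -/
def normSq (p : ℝ × ℝ) : ℝ := p.1 ^ 2 + p.2 ^ 2

theorem contDiff_normSq : ContDiff ℝ ∞ normSq := by unfold normSq; fun_prop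

theorem norm_le_of_normSq_le {p : ℝ × ℝ} {R : ℝ} (hR : 0 ≤ R) (h : normSq p ≤ R ^ 2) :
    ‖p‖ ≤ R := by
  unfold normSq at h
  refine max_le ?_ ?_ <;> rw [Real.norm_eq_abs] <;> refine abs_le_of_sq_le_sq ?_ hR <;>
    nlinarith [sq_nonneg p.1, sq_nonneg p.2]

/-- A radial mollifier of radius `δ` (not normalized). -/
def kernel (δ : ℝ) (p : ℝ × ℝ) : ℝ := deriv step (normSq p / δ ^ 2) / δ ^ 2

theorem contDiff_kernel (δ : ℝ) : ContDiff ℝ ∞ (kernel δ) :=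
  (contDiff_deriv_step.comp (contDiff_normSq.div_const _)).div_const _

theorem kernel_nonneg (δ : ℝ) (p : ℝ × ℝ) : 0 ≤ kernel δ p :=
  div_nonneg monotone_step.deriv_nonneg (sq_nonneg _)

theorem kernel_eq_zero {δ : ℝ} (hδ : 0 < δ) {p : ℝ × ℝ} (h : δ < ‖p‖) : kernel δ p = 0 := by
  have : 1 < normSq p / δ ^ 2 := by
    rw [one_lt_div (by positivity)]
    by_contra! h'
    exact absurd (norm_le_of_normSq_le hδ.le h') (not_le.2 h)
  rw [kernel, deriv_step_eq_zero this, zero_div]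

theorem hasCompactSupport_kernel {δ : ℝ} (hδ : 0 < δ) : HasCompactSupport (kernel δ) :=
  HasCompactSupport.intro (isCompact_closedBall 0 δ) fun p hp => kernel_eq_zero hδ (by
    simpa using hp)

/-- The total mass of the mollifiers. -/
def kernelMass : ℝ := ∫ p, kernel 1 p

/-- In the plane the Jacobian `δ²` of the scaling cancels the division by `δ²` in `kernel`, so the
mass does not depend on the radius. -/
theorem integral_kernel {δ : ℝ} (hδ : 0 < δ) : ∫ p, kernel δ p = kernelMass := by
  have h : ∀ p, kernel δ p = kernel 1 (δ⁻¹ • p) / δ ^ 2 := fun p => by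
    simp only [kernel, normSq, Prod.smul_fst, Prod.smul_snd, smul_eq_mul]
    field_simp
  simp only [h]
  rw [integral_div, Measure.integral_comp_smul, kernelMass, Module.finrank_prod,
    Module.finrank_self, smul_eq_mul, abs_of_pos (by positivity), one_add_one_eq_two, inv_pow, inv_inv,
    mul_div_cancel_left₀ _ (by positivity)]

theorem kernelMass_pos : 0 < kernelMass := by
  -- The step rises from `0` to `1` on `[0, 1]`, so its derivative equals `1` at some `s`, and the
  -- kernel is positive at distance `√s`.
  obtain ⟨s, hs, hd⟩ := exists_deriv_eq_slope step zero_lt_one contDiff_step.continuous.continuousOn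
    (contDiff_step.differentiable (by simp)).differentiableOn
  rw [step_eq_one le_rfl, step_eq_zero (by norm_num)] at hd
  refine (contDiff_kernel 1).continuous.integral_pos_of_hasCompactSupport_nonneg_nonzero
    (hasCompactSupport_kernel one_pos) (kernel_nonneg 1) (x := (√s, 0)) ?_
  simp [kernel, normSq, Real.sq_sqrt hs.1.le, hd]

/-- The derivative of `profile δ δ'`, as a function of the squared distance. -/
def profileDeriv (δ δ' s : ℝ) : ℝ := (step (s / δ ^ 2) - step (s / δ' ^ 2)) / s

/-- Division by `s` does no harm at `0`: `step` vanishes up to `1 / 2`, so the numerator is zero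
near the origin. -/
theorem contDiff_profileDeriv {δ δ' : ℝ} (hδ : 0 < δ) (hδ' : 0 < δ') :
    ContDiff ℝ ∞ (profileDeriv δ δ') := by
  refine contDiff_iff_contDiffAt.2 fun s => ?_
  have hn : ContDiff ℝ ∞ fun s => step (s / δ ^ 2) - step (s / δ' ^ 2) :=
    (contDiff_step.comp (contDiff_id.div_const _)).sub (contDiff_step.comp (contDiff_id.div_const _))
  rcases eq_or_ne s 0 with rfl | hs
  · have h1 : ∀ δ : ℝ, 0 < δ → ∀ᶠ s in 𝓝 (0 : ℝ), step (s / δ ^ 2) = 0 := fun δ hδ => by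
      have : (0 : ℝ) < δ ^ 2 / 2 := by positivity
      filter_upwards [gt_mem_nhds this] with s hs
      refine step_eq_zero ?_
      rw [div_le_iff₀ (by positivity)]
      linarith
    have : profileDeriv δ δ' =ᶠ[𝓝 0] fun _ => 0 := by
      filter_upwards [h1 δ hδ, h1 δ' hδ'] with s h2 h3
      rw [profileDeriv, h2, h3, sub_zero, zero_div]
    exact contDiffAt_const.congr_of_eventuallyEq this
  · exact hn.contDiffAt.div contDiffAt_id hs

theorem profileDeriv_eq_zero {δ δ' s : ℝ} (hδ : 0 < δ) (hδ' : 0 < δ')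
    (h : max δ δ' ^ 2 ≤ s) : profileDeriv δ δ' s = 0 := by
  rw [profileDeriv, step_eq_one, step_eq_one, sub_self, zero_div]
  · rw [one_le_div (by positivity)]
    exact (pow_le_pow_left₀ hδ'.le (le_max_right _ _) 2).trans h
  · rw [one_le_div (by positivity)]
    exact (pow_le_pow_left₀ hδ.le (le_max_left _ _) 2).trans h

/-- For `f' = profileDeriv δ δ'` the left side is `(s f')'`, and `s f'` is a difference of two
steps, also at `s = 0`. `profileDeriv` is chosen for this. -/
theorem add_mul_deriv_profileDeriv {δ δ' : ℝ} (hδ : 0 < δ) (hδ' : 0 < δ') (s : ℝ) :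
    profileDeriv δ δ' s + s * deriv (profileDeriv δ δ') s =
      deriv step (s / δ ^ 2) / δ ^ 2 - deriv step (s / δ' ^ 2) / δ' ^ 2 := by
  have h0 : (fun s => s * profileDeriv δ δ' s) =
      fun s => step (s / δ ^ 2) - step (s / δ' ^ 2) := by
    ext s
    rcases eq_or_ne s 0 with rfl | hs
    · simp
    · rw [profileDeriv, mul_div_cancel₀ _ hs]
  have h1 : HasDerivAt (fun s => s * profileDeriv δ δ' s)
      (1 * profileDeriv δ δ' s + s * deriv (profileDeriv δ δ') s) s :=
    (hasDerivAt_id s).mul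
      ((contDiff_profileDeriv hδ hδ').differentiable (by simp) s).hasDerivAt
  have h2 : ∀ δ : ℝ, HasDerivAt (fun s => step (s / δ ^ 2))
      (deriv step (s / δ ^ 2) * (1 / δ ^ 2)) s := fun δ =>
    HasDerivAt.comp (h₂ := step) s (contDiff_step.differentiable (by simp) (s / δ ^ 2)).hasDerivAt
      ((hasDerivAt_id s).div_const _)
  have h3 := (h2 δ).sub (h2 δ')
  rw [h0] at h1
  have := h1.unique h3
  rw [one_mul] at this
  rw [this]
  ring

/-- An antiderivative of `profileDeriv δ δ'` that vanishes for large arguments. -/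
def profile (δ δ' s : ℝ) : ℝ := ∫ t in (max δ δ' ^ 2)..s, profileDeriv δ δ' t

theorem hasDerivAt_profile {δ δ' : ℝ} (hδ : 0 < δ) (hδ' : 0 < δ') (s : ℝ) :
    HasDerivAt (profile δ δ') (profileDeriv δ δ' s) s := by
  have hc := (contDiff_profileDeriv hδ hδ').continuous
  exact intervalIntegral.integral_hasDerivAt_right (hc.intervalIntegrable _ _)
    hc.aestronglyMeasurable.stronglyMeasurableAtFilter hc.continuousAt

theorem contDiff_profile {δ δ' : ℝ} (hδ : 0 < δ) (hδ' : 0 < δ') :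
    ContDiff ℝ ∞ (profile δ δ') := by
  refine contDiff_infty_iff_deriv.2 ⟨fun s => (hasDerivAt_profile hδ hδ' s).differentiableAt, ?_⟩
  have : deriv (profile δ δ') = profileDeriv δ δ' :=
    funext fun s => (hasDerivAt_profile hδ hδ' s).deriv
  rw [this]
  exact contDiff_profileDeriv hδ hδ'

theorem profile_eq_zero {δ δ' s : ℝ} (hδ : 0 < δ) (hδ' : 0 < δ')
    (h : max δ δ' ^ 2 ≤ s) : profile δ δ' s = 0 := by
  refine (intervalIntegral.integral_congr (g := fun _ => 0) fun t ht => ?_).trans (by simp)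
  rw [uIcc_of_le h] at ht
  exact profileDeriv_eq_zero hδ hδ' ht.1

/-- A radial function around `x`, supported in a small disc, whose Laplacian is a difference of two
mollifiers. -/
def potential (δ δ' : ℝ) (x y : ℝ × ℝ) : ℝ := profile δ δ' (normSq (y - x))

theorem hasFDerivAt_normSq_sub (x y : ℝ × ℝ) :
    HasFDerivAt (fun y => normSq (y - x)) ((2 * (y.1 - x.1)) • ContinuousLinearMap.fst ℝ ℝ ℝ +
      (2 * (y.2 - x.2)) • ContinuousLinearMap.snd ℝ ℝ ℝ) y := by
  have h1 : HasFDerivAt (fun y : ℝ × ℝ => y.1 - x.1) (ContinuousLinearMap.fst ℝ ℝ ℝ) y :=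
    hasFDerivAt_fst.sub_const _
  have h2 : HasFDerivAt (fun y : ℝ × ℝ => y.2 - x.2) (ContinuousLinearMap.snd ℝ ℝ ℝ) y :=
    hasFDerivAt_snd.sub_const _
  refine ((h1.pow 2).add (h2.pow 2)).congr_fderiv ?_
  ext <;> simp

theorem fderiv_comp_normSq_sub {f f' : ℝ → ℝ} (hf : ∀ s, HasDerivAt f (f' s) s) (x y : ℝ × ℝ) :
    HasFDerivAt (fun y => f (normSq (y - x))) (f' (normSq (y - x)) •
      ((2 * (y.1 - x.1)) • ContinuousLinearMap.fst ℝ ℝ ℝ +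
      (2 * (y.2 - x.2)) • ContinuousLinearMap.snd ℝ ℝ ℝ)) y :=
  HasDerivAt.comp_hasFDerivAt y (hf _) (hasFDerivAt_normSq_sub x y)

/-- In the plane, `Δ f(|y|²) = 4 (f' + s f'')` at `s = |y|²`; the bracket is computed by
`add_mul_deriv_profileDeriv`. -/
theorem laplacian_potential {δ δ' : ℝ} (hδ : 0 < δ) (hδ' : 0 < δ') (x y : ℝ × ℝ) :
    dx (dx (potential δ δ' x)) y + dy (dy (potential δ δ' x)) y =
      4 * (kernel δ (x - y) - kernel δ' (x - y)) := by
  have h1 : dx (potential δ δ' x) =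
      fun y => profileDeriv δ δ' (normSq (y - x)) * (2 * (y.1 - x.1)) := by
    ext y
    have h := fderiv_comp_normSq_sub (hasDerivAt_profile hδ hδ') x y
    change fderiv ℝ (fun y => profile δ δ' (normSq (y - x))) y _ = _
    rw [h.fderiv]
    simp
  have h2 : dy (potential δ δ' x) =
      fun y => profileDeriv δ δ' (normSq (y - x)) * (2 * (y.2 - x.2)) := by
    ext y
    have h := fderiv_comp_normSq_sub (hasDerivAt_profile hδ hδ') x y
    change fderiv ℝ (fun y => profile δ δ' (normSq (y - x))) y _ = _
    rw [h.fderiv]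
    simp
  have h3 := fderiv_comp_normSq_sub (fun s =>
    ((contDiff_profileDeriv hδ hδ').differentiable (by simp) s).hasDerivAt) x y
  have h4 : HasFDerivAt (fun y : ℝ × ℝ => 2 * (y.1 - x.1))
      ((2 : ℝ) • ContinuousLinearMap.fst ℝ ℝ ℝ) y := (hasFDerivAt_fst.sub_const _).const_mul 2
  have h5 : HasFDerivAt (fun y : ℝ × ℝ => 2 * (y.2 - x.2))
      ((2 : ℝ) • ContinuousLinearMap.snd ℝ ℝ ℝ) y := (hasFDerivAt_snd.sub_const _).const_mul 2
  have h6 := add_mul_deriv_profileDeriv hδ hδ' (normSq (x - y))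
  have h7 : normSq (y - x) = normSq (x - y) := by simp only [normSq, Prod.fst_sub, Prod.snd_sub]; ring
  rw [h1, h2, dx, dy, (h3.fun_mul h4).fderiv, (h3.fun_mul h5).fderiv, kernel, kernel, ← h6, h7]
  simp [normSq]
  ring

theorem isTest_potential {δ δ' : ℝ} (hδ : 0 < δ) (hδ' : 0 < δ') {x : ℝ × ℝ}
    (h : Metric.closedBall x (max δ δ') ⊆ square) : IsTest (potential δ δ' x) := by
  have hz : ∀ y, y ∉ Metric.closedBall x (max δ δ') → potential δ δ' x y = 0 := fun y hy => by
    refine profile_eq_zero hδ hδ' ?_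
    by_contra! h'
    refine hy ?_
    rw [Metric.mem_closedBall, dist_eq_norm]
    exact norm_le_of_normSq_le (hδ.le.trans (le_max_left _ _)) h'.le
  refine ⟨(contDiff_profile hδ hδ').comp (contDiff_normSq.comp (contDiff_id.sub contDiff_const)),
    HasCompactSupport.intro (isCompact_closedBall _ _) hz, Subset.trans ?_ h⟩
  exact closure_minimal (Function.support_subset_iff'.2 hz) Metric.isClosed_closedBall

/-- Mollification with a radial kernel. -/
def mollify (δ : ℝ) (u : ℝ × ℝ → ℝ) (x : ℝ × ℝ) : ℝ := ∫ y, u y * kernel δ (x - y)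

theorem contDiff_mollify {δ : ℝ} (hδ : 0 < δ) {u : ℝ × ℝ → ℝ} (hu : Integrable u) :
    ContDiff ℝ ∞ (mollify δ u) :=
  (hasCompactSupport_kernel hδ).contDiff_convolution_right (ContinuousLinearMap.mul ℝ ℝ)
    hu.locallyIntegrable (contDiff_kernel δ)

theorem bounded_kernel {δ : ℝ} (hδ : 0 < δ) : ∃ C, ∀ p, ‖kernel δ p‖ ≤ C :=
  (hasCompactSupport_kernel hδ).exists_bound_of_continuous (contDiff_kernel δ).continuous

theorem integrable_mul_kernel {δ : ℝ} (hδ : 0 < δ) {u : ℝ × ℝ → ℝ} (hu : Integrable u)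
    (x : ℝ × ℝ) : Integrable fun y => u y * kernel δ (x - y) := by
  obtain ⟨C, hC⟩ := bounded_kernel hδ
  refine hu.mul_bdd ?_ (ae_of_all _ fun y => hC _)
  exact ((contDiff_kernel δ).continuous.comp (by fun_prop)).aestronglyMeasurable

/-- A weak form of the mean value property: the difference of the two kernels is, up to the factor
`4`, the Laplacian of a test function, against which `u` integrates to zero. -/
theorem mollify_eq_mollify {u : ℝ × ℝ → ℝ} (hu : Integrable u)
    (h : ∀ φ, IsTest φ → ∫ p, u p * (dx (dx φ) p + dy (dy φ) p) = 0) {δ δ' : ℝ} (hδ : 0 < δ)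
    (hδ' : 0 < δ') {x : ℝ × ℝ} (hx : Metric.closedBall x δ ⊆ square)
    (hx' : Metric.closedBall x δ' ⊆ square) : mollify δ u x = mollify δ' u x := by
  have hb : Metric.closedBall x (max δ δ') ⊆ square := by
    rcases max_choice δ δ' with e | e <;> rwa [e]
  have h1 := h _ (isTest_potential hδ hδ' hb)
  simp only [laplacian_potential hδ hδ', mul_left_comm (u _) 4, mul_sub] at h1
  rw [integral_sub ((integrable_mul_kernel hδ hu x).const_mul 4)
    ((integrable_mul_kernel hδ' hu x).const_mul 4), integral_const_mul, integral_const_mul] at h1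
  unfold mollify
  linarith

theorem integral_mollify_mul {δ : ℝ} (hδ : 0 < δ) {u φ : ℝ × ℝ → ℝ} (hu : Integrable u)
    (hφ : Integrable φ) :
    Integrable (fun y => u y * ∫ x, kernel δ (x - y) * φ x) ∧
      ∫ x, mollify δ u x * φ x = ∫ y, u y * ∫ x, kernel δ (x - y) * φ x := by
  obtain ⟨C, hC⟩ := bounded_kernel hδ
  have hi : Integrable (fun z : (ℝ × ℝ) × (ℝ × ℝ) => φ z.1 * u z.2 * kernel δ (z.1 - z.2))
      (volume.prod volume) := by
    refine (hφ.mul_prod hu).mul_bdd ?_ (ae_of_all _ fun y => hC _)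
    exact ((contDiff_kernel δ).continuous.comp (by fun_prop)).aestronglyMeasurable
  have e2 : ∀ y, ∫ x, φ x * u y * kernel δ (x - y) = u y * ∫ x, kernel δ (x - y) * φ x :=
    fun y => by
      rw [← integral_const_mul]
      exact integral_congr_ae (ae_of_all _ fun x => by ring)
  have e1 : ∀ x, ∫ y, φ x * u y * kernel δ (x - y) = mollify δ u x * φ x := fun x => by
    rw [mollify, ← integral_mul_const]
    exact integral_congr_ae (ae_of_all _ fun y => by ring)
  constructor
  · have := hi.integral_prod_right
    simpa only [e2] using this
  · have := integral_integral_swap (f := fun x y => φ x * u y * kernel δ (x - y)) hi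
    simpa only [e1, e2] using this

/-- The kernel has mass `kernelMass` and only sees points within `δ` of `y`, where `φ` differs from
`φ y` by at most `η`. -/
theorem abs_integral_kernel_mul_sub_le {δ : ℝ} (hδ : 0 < δ) {φ : ℝ × ℝ → ℝ} (hφ : Continuous φ)
    {η : ℝ} {y : ℝ × ℝ} (h : ∀ x, dist x y ≤ δ → |φ x - φ y| ≤ η) :
    |(∫ x, kernel δ (x - y) * φ x) - kernelMass * φ y| ≤ kernelMass * η := by
  have hk : Continuous fun x => kernel δ (x - y) :=
    (contDiff_kernel δ).continuous.comp (by fun_prop)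
  have hs : HasCompactSupport fun x => kernel δ (x - y) :=
    HasCompactSupport.intro (isCompact_closedBall y δ) fun p hp => kernel_eq_zero hδ (by
      simpa [dist_eq_norm] using hp)
  have hm : ∫ x, kernel δ (x - y) = kernelMass := by
    rw [integral_sub_right_eq_self (kernel δ) y, integral_kernel hδ]
  have i0 : Integrable fun x => kernel δ (x - y) := hk.integrable_of_hasCompactSupport hs
  have i1 : Integrable fun x => kernel δ (x - y) * φ x :=
    (hk.mul hφ).integrable_of_hasCompactSupport hs.mul_right
  rw [← hm, ← integral_mul_const, ← integral_mul_const, ← integral_sub i1 (i0.mul_const _)]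
  rw [← Real.norm_eq_abs]
  refine norm_integral_le_of_norm_le (i0.mul_const η) (ae_of_all _ fun x => ?_)
  rw [← mul_sub, norm_mul, Real.norm_of_nonneg (kernel_nonneg _ _)]
  by_cases hx : dist x y ≤ δ
  · exact mul_le_mul_of_nonneg_left (h x hx) (kernel_nonneg _ _)
  · rw [kernel_eq_zero hδ (by rw [← dist_eq_norm]; exact not_le.1 hx), zero_mul, zero_mul]

/-- **Weyl's lemma**: a weakly harmonic function is smooth. -/
theorem weyl {u : ℝ × ℝ → ℝ} (hu : MemLp u 2 area)
    (h : ∀ φ, IsTest φ → ∫ p, u p * (dx (dx φ) p + dy (dy φ) p) ∂area = 0) :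
    ∃ q, ContDiffOn ℝ ∞ q square ∧ u =ᵐ[area] q := by
  set v := square.indicator u with hv
  have hvi : Integrable v :=
    (integrable_indicator_iff measurableSet_square).2 (hu.integrable (by norm_num))
  have hvu : ∀ ψ : ℝ × ℝ → ℝ, ∫ p, u p * ψ p ∂area = ∫ p, v p * ψ p := fun ψ => by
    rw [area, ← integral_indicator measurableSet_square]
    refine integral_congr_ae (ae_of_all _ fun p => ?_)
    by_cases hp : p ∈ square <;> simp [hv, hp]
  have hharm : ∀ φ, IsTest φ → ∫ p, v p * (dx (dx φ) p + dy (dy φ) p) = 0 := fun φ hφ => by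
    rw [← hvu, h φ hφ]
  have hm := kernelMass_pos
  let r : ℝ × ℝ → ℝ := fun x => Metric.infDist x squareᶜ / 2
  have hne : (squareᶜ : Set (ℝ × ℝ)).Nonempty := ⟨(0, 0), by simp [square]⟩
  have hr0 : ∀ x ∈ square, 0 < r x := fun x hx => half_pos
    ((isOpen_square.isClosed_compl.notMem_iff_infDist_pos hne).1 (by simpa using hx))
  have hr : ∀ x ∈ square, Metric.closedBall x (r x) ⊆ square := fun x hx =>
    (Metric.closedBall_subset_ball (half_lt_self (by
      have := hr0 x hx; simp only [r] at this; linarith))).trans Metric.ball_infDist_compl_subset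
  -- The radius varies with `x`, but by `mollify_eq_mollify` any radius that fits in the square
  -- gives the same value. Near a given point one fixed radius serves, hence `q` is smooth.
  let q : ℝ × ℝ → ℝ := fun x => kernelMass⁻¹ * mollify (r x) v x
  have hq : ∀ x ∈ square, ∀ δ, 0 < δ → Metric.closedBall x δ ⊆ square →
      q x = kernelMass⁻¹ * mollify δ v x := fun x hx δ hδ hb => by
    simp only [q, mollify_eq_mollify hvi hharm (hr0 x hx) hδ (hr x hx) hb]
  have hqs : ContDiffOn ℝ ∞ q square := by
    intro x hx
    have h0 := hr0 x hx
    have he : q =ᶠ[𝓝 x] fun y => kernelMass⁻¹ * mollify (r x / 2) v y := by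
      filter_upwards [Metric.ball_mem_nhds x (half_pos h0)] with y hy
      have hb : Metric.closedBall y (r x / 2) ⊆ Metric.closedBall x (r x) :=
        Metric.closedBall_subset_closedBall' (by linarith [Metric.mem_ball.1 hy])
      exact hq y (hr x hx (hb (Metric.mem_closedBall_self (by linarith)))) _ (half_pos h0)
        (hb.trans (hr x hx))
    exact ((contDiff_const.mul (contDiff_mollify (half_pos h0) hvi)).contDiffAt.congr_of_eventuallyEq
      he).contDiffWithinAt
  refine ⟨q, hqs, ae_eq_of_forall_isTest hu hqs.continuousOn fun φ hφ => ?_⟩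
  obtain ⟨δ₀, hδ₀, hthick⟩ := hφ.2.1.isCompact.exists_cthickening_subset_open isOpen_square hφ.2.2
  have hφi : Integrable φ := hφ.1.continuous.integrable_of_hasCompactSupport hφ.2.1
  rw [hvu, hφ.integral_area]
  have hvφ : Integrable fun p => v p * φ p := by
    obtain ⟨C, hC⟩ := hφ.2.1.exists_bound_of_continuous hφ.1.continuous
    exact hvi.mul_bdd hφ.1.continuous.aestronglyMeasurable (ae_of_all _ hC)
  -- On the support of `φ` one small radius `δ` serves for all points. Fubini moves the
  -- mollification from `v` to `φ`, where uniform continuity makes the error small.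
  have key : ∀ η > 0, |(∫ p, q p * φ p) - ∫ p, v p * φ p| ≤ η * ∫ p, |v p| := by
    intro η hη
    obtain ⟨δ₁, hδ₁, hu1⟩ := Metric.uniformContinuous_iff.1
      (hφ.2.1.uniformContinuous_of_continuous hφ.1.continuous) η hη
    set δ := min δ₀ (δ₁ / 2) with hδdef
    have hδ : 0 < δ := lt_min hδ₀ (half_pos hδ₁)
    have e1 : ∫ p, q p * φ p = kernelMass⁻¹ * ∫ x, mollify δ v x * φ x := by
      rw [← integral_const_mul]
      refine integral_congr_ae (ae_of_all _ fun x => ?_)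
      by_cases hx : x ∈ tsupport φ
      · have hb : Metric.closedBall x δ ⊆ square :=
          (Metric.closedBall_subset_closedBall (min_le_left _ _)).trans
            ((Metric.closedBall_subset_cthickening hx δ₀).trans hthick)
        simp only [hq x (hφ.2.2 hx) δ hδ hb, mul_assoc]
      · simp only [image_eq_zero_of_notMem_tsupport hx, mul_zero]
    obtain ⟨i1, e2⟩ := integral_mollify_mul hδ hvi hφi
    rw [e1, e2, ← integral_const_mul, ← integral_sub (i1.const_mul _) hvφ, ← integral_const_mul]
    rw [← Real.norm_eq_abs]
    refine norm_integral_le_of_norm_le (hvi.abs.const_mul η) (ae_of_all _ fun y => ?_)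
    have h1 := abs_integral_kernel_mul_sub_le hδ hφ.1.continuous (η := η) (y := y) fun x hx =>
      (hu1 (lt_of_le_of_lt (hx.trans (min_le_right _ _)) (half_lt_self hδ₁))).le
    have h2 : kernelMass⁻¹ * (v y * ∫ x, kernel δ (x - y) * φ x) - v y * φ y =
        kernelMass⁻¹ * v y * ((∫ x, kernel δ (x - y) * φ x) - kernelMass * φ y) := by
      field_simp
    rw [h2, Real.norm_eq_abs, abs_mul, abs_mul, abs_of_pos (inv_pos.2 hm)]
    calc kernelMass⁻¹ * |v y| * _ ≤ kernelMass⁻¹ * |v y| * (kernelMass * η) := by gcongr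
      _ = η * |v y| := by field_simp
  have hI : 0 ≤ ∫ p, |v p| := integral_nonneg fun p => abs_nonneg _
  have h0 : |(∫ p, q p * φ p) - ∫ p, v p * φ p| ≤ 0 := by
    refine le_of_forall_pos_le_add fun ε hε => ?_
    -- The summand `1` keeps the denominator positive when `v` vanishes.
    refine (key (ε / (1 + ∫ p, |v p|)) (by positivity)).trans ?_
    rw [zero_add, div_mul_eq_mul_div, div_le_iff₀ (by positivity)]
    nlinarith
  exact (sub_eq_zero.1 (abs_nonpos_iff.1 h0)).symm

/-! ### The energy, minimizing sequences and uniqueness -/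

/-- The energy in terms of the gradient `(a, b)` and the boundary values `t`. -/
def energy (τ : ℝ) (g a b t : ℝ × ℝ → ℝ) : ℝ :=
  ∫ p, (a p ^ 2 + b p ^ 2) ∂area + ∫ p, τ * (t p - g p) ^ 2 ∂arcLength

/-- The energy of a function that is smooth up to the boundary. -/
def smoothEnergy (τ : ℝ) (g φ : ℝ × ℝ → ℝ) : ℝ := energy τ g (dx φ) (dy φ) φ

section Energy

variable {τ : ℝ} {g : ℝ × ℝ → ℝ}

theorem energy_eq {a b : ℝ × ℝ → ℝ} (t : ℝ × ℝ → ℝ) (ha : MemLp a 2 area) (hb : MemLp b 2 area) :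
    energy τ g a b t =
      ∫ p, a p ^ 2 ∂area + ∫ p, b p ^ 2 ∂area + τ * ∫ p, (t p - g p) ^ 2 ∂arcLength := by
  rw [energy, integral_add ha.integrable_sq hb.integrable_sq, integral_const_mul]

theorem energy_congr {a a' b b' t t' : ℝ × ℝ → ℝ} (ha : a =ᵐ[area] a') (hb : b =ᵐ[area] b')
    (ht : t =ᵐ[arcLength] t') : energy τ g a b t = energy τ g a' b' t' := by
  unfold energy
  congr 1
  · refine integral_congr_ae ?_
    filter_upwards [ha, hb] with p h1 h2
    rw [h1, h2]
  · refine integral_congr_ae ?_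
    filter_upwards [ht] with p h1
    rw [h1]

theorem tendsto_energy (hg : MemLp g 2 arcLength) {a b t : ℕ → ℝ × ℝ → ℝ} {A B T : ℝ × ℝ → ℝ}
    (ha : L2Tendsto area a A) (hb : L2Tendsto area b B) (ht : L2Tendsto arcLength t T) :
    Tendsto (fun n => energy τ g (a n) (b n) (t n)) atTop (𝓝 (energy τ g A B T)) := by
  rw [energy_eq T ha.memLp_lim hb.memLp_lim]
  simp only [fun n => energy_eq (τ := τ) (g := g) (t n) (ha.memLp n) (hb.memLp n)]
  exact (ha.integral_sq.add hb.integral_sq).add ((ht.sub (.const hg)).integral_sq.const_mul τ)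

theorem memLp_dx {φ : ℝ × ℝ → ℝ} (h : ContDiff ℝ ∞ φ) : MemLp (dx φ) 2 area :=
  memLp_area (continuous_dx h)

theorem memLp_dy {φ : ℝ × ℝ → ℝ} (h : ContDiff ℝ ∞ φ) : MemLp (dy φ) 2 area :=
  memLp_area (continuous_dy h)

theorem smoothEnergy_nonneg (hτ : 0 < τ) (φ : ℝ × ℝ → ℝ) : 0 ≤ smoothEnergy τ g φ :=
  add_nonneg (integral_nonneg fun _ => by positivity) (integral_nonneg fun _ => by positivity)

theorem J_eq_smoothEnergy {φ : ℝ × ℝ → ℝ} (h : ContDiff ℝ ∞ φ) :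
    J φ τ g = smoothEnergy τ g φ :=
  energy_congr (ae_eq_refl _) (ae_eq_refl _) (trace_ae_eq_of_contDiff h)

theorem dx_midpoint {φ ψ : ℝ × ℝ → ℝ} (hφ : ContDiff ℝ ∞ φ) (hψ : ContDiff ℝ ∞ ψ) (p : ℝ × ℝ) :
    dx (fun p => (1 / 2 : ℝ) * (φ p + ψ p)) p = 1 / 2 * (dx φ p + dx ψ p) := by
  have h1 := hφ.differentiable (by simp) p
  have h2 := hψ.differentiable (by simp) p
  unfold dx
  rw [fderiv_const_mul (h1.fun_add h2), fderiv_fun_add h1 h2]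
  simp
  ring

theorem dy_midpoint {φ ψ : ℝ × ℝ → ℝ} (hφ : ContDiff ℝ ∞ φ) (hψ : ContDiff ℝ ∞ ψ) (p : ℝ × ℝ) :
    dy (fun p => (1 / 2 : ℝ) * (φ p + ψ p)) p = 1 / 2 * (dy φ p + dy ψ p) := by
  have h1 := hφ.differentiable (by simp) p
  have h2 := hψ.differentiable (by simp) p
  unfold dy
  rw [fderiv_const_mul (h1.fun_add h2), fderiv_fun_add h1 h2]
  simp
  ring

theorem integral_parallelogram {α : Type*} [MeasurableSpace α] {μ : Measure α} {a b : α → ℝ}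
    (ha : MemLp a 2 μ) (hb : MemLp b 2 μ) :
    ∫ p, (a p - b p) ^ 2 ∂μ =
      2 * ∫ p, a p ^ 2 ∂μ + 2 * ∫ p, b p ^ 2 ∂μ - 4 * ∫ p, (1 / 2 * (a p + b p)) ^ 2 ∂μ := by
  have i1 := ha.integrable_sq
  have i2 := hb.integrable_sq
  have i3 : Integrable (fun p => (1 / 2 * (a p + b p)) ^ 2) μ :=
    ((ha.add hb).const_mul (1 / 2)).integrable_sq
  have i4 : Integrable (fun p => 2 * a p ^ 2 + 2 * b p ^ 2) μ :=
    (i1.const_mul 2).add (i2.const_mul 2)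
  rw [← integral_const_mul, ← integral_const_mul, ← integral_const_mul,
    ← integral_add (i1.const_mul 2) (i2.const_mul 2),
    ← integral_sub i4 (i3.const_mul 4)]
  exact integral_congr_ae (ae_of_all _ fun p => by ring)

/-- Uniform convexity of the energy. -/
theorem smoothEnergy_parallelogram (hg : MemLp g 2 arcLength) {φ ψ : ℝ × ℝ → ℝ}
    (hφ : ContDiff ℝ ∞ φ) (hψ : ContDiff ℝ ∞ ψ) :
    ∫ p, (dx φ p - dx ψ p) ^ 2 ∂area + ∫ p, (dy φ p - dy ψ p) ^ 2 ∂area +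
        τ * ∫ p, (φ p - ψ p) ^ 2 ∂arcLength =
      2 * smoothEnergy τ g φ + 2 * smoothEnergy τ g ψ -
        4 * smoothEnergy τ g (fun p => 1 / 2 * (φ p + ψ p)) := by
  have hm : ContDiff ℝ ∞ fun p => (1 / 2 : ℝ) * (φ p + ψ p) := contDiff_const.mul (hφ.add hψ)
  have h1 := integral_parallelogram (memLp_dx hφ) (memLp_dx hψ)
  have h2 := integral_parallelogram (memLp_dy hφ) (memLp_dy hψ)
  have h3 := integral_parallelogram ((memLp_arcLength hφ.continuous).sub hg)
    ((memLp_arcLength hψ.continuous).sub hg)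
  have e2 : ∀ p, 1 / 2 * (φ p - g p + (ψ p - g p)) = 1 / 2 * (φ p + ψ p) - g p := fun p => by
    ring
  simp only [Pi.sub_apply, sub_sub_sub_cancel_right, e2] at h3
  unfold smoothEnergy
  rw [energy_eq _ (memLp_dx hφ) (memLp_dy hφ), energy_eq _ (memLp_dx hψ) (memLp_dy hψ),
    energy_eq _ (memLp_dx hm) (memLp_dy hm), h1, h2, h3]
  simp only [dx_midpoint hφ hψ, dy_midpoint hφ hψ]
  ring

/-- The infimum of the energy over the functions that are smooth up to the boundary. -/
def energyInf (τ : ℝ) (g : ℝ × ℝ → ℝ) : ℝ := sInf (smoothEnergy τ g '' {φ | ContDiff ℝ ∞ φ})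

theorem energyInf_le (hτ : 0 < τ) {φ : ℝ × ℝ → ℝ} (h : ContDiff ℝ ∞ φ) :
    energyInf τ g ≤ smoothEnergy τ g φ :=
  csInf_le ⟨0, by rintro _ ⟨φ, -, rfl⟩; exact smoothEnergy_nonneg hτ φ⟩ ⟨φ, h, rfl⟩

/-- Minimizing sequences of functions that are smooth up to the boundary. -/
structure IsMinimizing (τ : ℝ) (g : ℝ × ℝ → ℝ) (φ : ℕ → ℝ × ℝ → ℝ) : Prop where
  contDiff : ∀ n, ContDiff ℝ ∞ (φ n)
  tendsto : Tendsto (fun n => smoothEnergy τ g (φ n)) atTop (𝓝 (energyInf τ g))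

theorem smoothEnergy_image_nonempty :
    (smoothEnergy τ g '' {φ | ContDiff ℝ ∞ φ}).Nonempty :=
  ⟨_, mem_image_of_mem _ (show ContDiff ℝ ∞ (fun _ : ℝ × ℝ => (0 : ℝ)) from contDiff_const)⟩

theorem exists_isMinimizing (hτ : 0 < τ) : ∃ φ, IsMinimizing τ g φ := by
  obtain ⟨u, -, hu, hmem⟩ := exists_seq_tendsto_sInf (smoothEnergy_image_nonempty (τ := τ) (g := g))
    ⟨0, by rintro _ ⟨φ, -, rfl⟩; exact smoothEnergy_nonneg hτ φ⟩
  choose φ hφ he using hmem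
  exact ⟨φ, hφ, hu.congr fun n => (he n).symm⟩

/-- The midpoint has energy at least the infimum, so the parallelogram identity bounds the distance
by an energy excess that tends to `0`. Two independent indices let one statement serve twice: `ψ =
φ` gives the Cauchy property, the diagonal gives uniqueness of limits. -/
theorem IsMinimizing.tendsto_dist (hτ : 0 < τ) (hg : MemLp g 2 arcLength)
    {φ ψ : ℕ → ℝ × ℝ → ℝ} (hφ : IsMinimizing τ g φ) (hψ : IsMinimizing τ g ψ) :
    Tendsto (fun n : ℕ × ℕ => ∫ p, (φ n.1 p - ψ n.2 p) ^ 2 ∂area) atTop (𝓝 0) ∧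
    Tendsto (fun n : ℕ × ℕ => ∫ p, (dx (φ n.1) p - dx (ψ n.2) p) ^ 2 ∂area) atTop (𝓝 0) ∧
    Tendsto (fun n : ℕ × ℕ => ∫ p, (dy (φ n.1) p - dy (ψ n.2) p) ^ 2 ∂area) atTop (𝓝 0) ∧
    Tendsto (fun n : ℕ × ℕ => ∫ p, (φ n.1 p - ψ n.2 p) ^ 2 ∂arcLength) atTop (𝓝 0) := by
  let D : ℕ × ℕ → ℝ := fun n => 2 * smoothEnergy τ g (φ n.1) + 2 * smoothEnergy τ g (ψ n.2) -
    4 * energyInf τ g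
  have hD : Tendsto D atTop (𝓝 0) := by
    have h1 := (((hφ.tendsto.comp tendsto_fst).const_mul 2).add
      ((hψ.tendsto.comp tendsto_snd).const_mul 2)).sub_const (4 * energyInf τ g)
    rw [prod_atTop_atTop_eq] at h1
    rwa [show 2 * energyInf τ g + 2 * energyInf τ g - 4 * energyInf τ g = 0 by ring] at h1
  have key : ∀ n : ℕ × ℕ, ∫ p, (dx (φ n.1) p - dx (ψ n.2) p) ^ 2 ∂area +
      ∫ p, (dy (φ n.1) p - dy (ψ n.2) p) ^ 2 ∂area +
      τ * ∫ p, (φ n.1 p - ψ n.2 p) ^ 2 ∂arcLength ≤ D n := fun n => by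
    have h1 := smoothEnergy_parallelogram (τ := τ) hg (hφ.contDiff n.1) (hψ.contDiff n.2)
    have h2 : energyInf τ g ≤ smoothEnergy τ g (fun p => 1 / 2 * (φ n.1 p + ψ n.2 p)) :=
      energyInf_le hτ (contDiff_const.mul ((hφ.contDiff n.1).add (hψ.contDiff n.2)))
    simp only [D]
    linarith
  have n1 : ∀ n : ℕ × ℕ, 0 ≤ ∫ p, (dx (φ n.1) p - dx (ψ n.2) p) ^ 2 ∂area := fun n =>
    integral_nonneg fun p => sq_nonneg _
  have n2 : ∀ n : ℕ × ℕ, 0 ≤ ∫ p, (dy (φ n.1) p - dy (ψ n.2) p) ^ 2 ∂area := fun n =>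
    integral_nonneg fun p => sq_nonneg _
  have n3 : ∀ n : ℕ × ℕ, 0 ≤ ∫ p, (φ n.1 p - ψ n.2 p) ^ 2 ∂arcLength := fun n =>
    integral_nonneg fun p => sq_nonneg _
  have n4 : ∀ n : ℕ × ℕ, 0 ≤ ∫ p, (φ n.1 p - ψ n.2 p) ^ 2 ∂area := fun n =>
    integral_nonneg fun p => sq_nonneg _
  have t3 : ∀ n : ℕ × ℕ, ∫ p, (φ n.1 p - ψ n.2 p) ^ 2 ∂arcLength ≤ τ⁻¹ * D n := fun n => by
    rw [inv_mul_eq_div, le_div_iff₀ hτ]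
    linarith [key n, n1 n, n2 n]
  have hz : ∀ C : ℝ, Tendsto (fun n => C * D n) atTop (𝓝 0) := fun C => by
    simpa using hD.const_mul C
  -- The constant is that of the Poincaré inequality: twice the boundary term, at most `τ⁻¹ * D n`,
  -- plus twice the gradient term, at most `D n`.
  refine ⟨squeeze_zero n4 (fun n => ?_) (hz (2 * τ⁻¹ + 2)),
    squeeze_zero n1 (fun n => ?_) hD, squeeze_zero n2 (fun n => ?_) hD,
    squeeze_zero n3 t3 (hz τ⁻¹)⟩
  · have hd := (hφ.contDiff n.1).sub (hψ.contDiff n.2)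
    have h1 := poincare_inequality hd
    rw [integral_grad_sq hd] at h1
    simp only [dx_sub (hφ.contDiff n.1) (hψ.contDiff n.2),
      dy_sub (hφ.contDiff n.1) (hψ.contDiff n.2)] at h1
    nlinarith [t3 n, key n, mul_nonneg hτ.le (n3 n)]
  · linarith [key n, n2 n, mul_nonneg hτ.le (n3 n)]
  · linarith [key n, n1 n, mul_nonneg hτ.le (n3 n)]

theorem Admissible.tendsto_smoothEnergy (hg : MemLp g 2 arcLength) {q : ℝ × ℝ → ℝ}
    (hq : Admissible q) : ∃ φ, Approximates φ q (trace q) ∧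
      Tendsto (fun n => smoothEnergy τ g (φ n)) atTop (𝓝 (J q τ g)) := by
  obtain ⟨φ, hφ⟩ := hq.isTrace_trace.exists_approximates hq
  exact ⟨φ, hφ, tendsto_energy hg hφ.dx hφ.dy hφ.bdry⟩

/-- By density, passing from functions smooth up to the boundary to all admissible ones does not
lower the infimum. -/
theorem energyInf_le_J (hτ : 0 < τ) (hg : MemLp g 2 arcLength) {q : ℝ × ℝ → ℝ}
    (hq : Admissible q) : energyInf τ g ≤ J q τ g := by
  obtain ⟨φ, hφ, h⟩ := hq.tendsto_smoothEnergy (τ := τ) hg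
  exact ge_of_tendsto' h fun n => energyInf_le hτ (hφ.contDiff n)

/-- A minimizer is the limit of a minimizing sequence. -/
theorem IsArgMin.exists_isMinimizing (hτ : 0 < τ) (hg : MemLp g 2 arcLength) {q : ℝ × ℝ → ℝ}
    (hq : IsArgMin τ g q) : ∃ φ, Approximates φ q (trace q) ∧ IsMinimizing τ g φ := by
  obtain ⟨φ, hφ, h⟩ := hq.1.tendsto_smoothEnergy (τ := τ) hg
  have hJ : J q τ g = energyInf τ g := by
    refine le_antisymm (le_csInf smoothEnergy_image_nonempty ?_) (energyInf_le_J hτ hg hq.1)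
    rintro _ ⟨ψ, hψ, rfl⟩
    rw [← J_eq_smoothEnergy hψ]
    exact hq.2 ψ (admissible_of_contDiff hψ)
  exact ⟨φ, hφ, hφ.contDiff, hJ ▸ h⟩

theorem ae_eq_of_isMinimizing (hτ : 0 < τ) (hg : MemLp g 2 arcLength) {φ ψ : ℕ → ℝ × ℝ → ℝ}
    (hφ : IsMinimizing τ g φ) (hψ : IsMinimizing τ g ψ) {q q' t t' : ℝ × ℝ → ℝ}
    (h : L2Tendsto area φ q) (h' : L2Tendsto area ψ q') (ht : L2Tendsto arcLength φ t)
    (ht' : L2Tendsto arcLength ψ t') : q =ᵐ[area] q' ∧ t =ᵐ[arcLength] t' := by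
  obtain ⟨h1, -, -, h2⟩ := hφ.tendsto_dist hτ hg hψ
  exact ⟨h.ae_eq h' (h1.comp tendsto_atTop_diagonal), ht.ae_eq ht' (h2.comp tendsto_atTop_diagonal)⟩

/-- Uniqueness of the minimizer. -/
theorem IsArgMin.eqOn (hτ : 0 < τ) (hg : MemLp g 2 arcLength) {q q' : ℝ × ℝ → ℝ}
    (hq : IsArgMin τ g q) (hq' : IsArgMin τ g q') : EqOn q q' square := by
  obtain ⟨φ, h1, h2⟩ := hq.exists_isMinimizing hτ hg
  obtain ⟨ψ, h3, h4⟩ := hq'.exists_isMinimizing hτ hg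
  exact Measure.eqOn_open_of_ae_eq (ae_eq_of_isMinimizing hτ hg h2 h4 h1.val h3.val h1.bdry h3.bdry).1
    isOpen_square hq.1.1.continuousOn hq'.1.1.continuousOn

/-! ### Symmetry of the minimizer -/

theorem integral_comp_measurePreserving {α : Type*} [MeasurableSpace α] {μ : Measure α}
    {σ : α → α} (hσ : MeasurePreserving σ μ μ) {f : α → ℝ} (hf : AEStronglyMeasurable f μ) :
    ∫ p, f (σ p) ∂μ = ∫ p, f p ∂μ := by
  conv_rhs => rw [← hσ.map_eq]
  rw [integral_map hσ.measurable.aemeasurable (by rwa [hσ.map_eq])]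

theorem dx_neg (φ : ℝ × ℝ → ℝ) (p : ℝ × ℝ) : dx (fun p => -φ p) p = -dx φ p := by
  simp [dx, fderiv_fun_neg]

theorem dy_neg (φ : ℝ × ℝ → ℝ) (p : ℝ × ℝ) : dy (fun p => -φ p) p = -dy φ p := by
  simp [dy, fderiv_fun_neg]

/-- If `σ` is a symmetry of the square under which the datum `g` is odd, then so is the
minimizer. -/
theorem IsArgMin.odd (hτ : 0 < τ) (hg : MemLp g 2 arcLength) {q : ℝ × ℝ → ℝ}
    (hq : IsArgMin τ g q) {σ : ℝ × ℝ → ℝ × ℝ} (hσ : ContDiff ℝ ∞ σ)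
    (h1 : MeasurePreserving σ area area) (h2 : MeasurePreserving σ arcLength arcLength)
    (hm : MapsTo σ square square)
    (hgrad : ∀ φ : ℝ × ℝ → ℝ, ContDiff ℝ ∞ φ → ∀ p, dx (fun p => φ (σ p)) p ^ 2 +
      dy (fun p => φ (σ p)) p ^ 2 = dx φ (σ p) ^ 2 + dy φ (σ p) ^ 2)
    (hodd : ∀ᵐ p ∂arcLength, g (σ p) = -g p) :
    (∀ p ∈ square, q p = -q (σ p)) ∧ ∀ᵐ p ∂arcLength, trace q p = -trace q (σ p) := by
  obtain ⟨φ, ha, hφ⟩ := hq.exists_isMinimizing hτ hg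
  have hs : ∀ n, smoothEnergy τ g (fun p => -φ n (σ p)) = smoothEnergy τ g (φ n) := fun n => by
    have c1 := continuous_dx (hφ.contDiff n)
    have c2 := continuous_dy (hφ.contDiff n)
    unfold smoothEnergy energy
    congr 1
    · simp only [dx_neg (fun p => φ n (σ p)), dy_neg (fun p => φ n (σ p)), neg_sq,
        hgrad _ (hφ.contDiff n)]
      exact integral_comp_measurePreserving h1 (f := fun p => dx (φ n) p ^ 2 + dy (φ n) p ^ 2)
        (Continuous.aestronglyMeasurable (by fun_prop))
    · have m0 : AEStronglyMeasurable (fun p => φ n p - g p) arcLength :=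
        (memLp_arcLength (hφ.contDiff n).continuous).1.sub hg.1
      have m1 : AEStronglyMeasurable (fun p => τ * (φ n p - g p) ^ 2) arcLength :=
        (m0.pow 2).const_mul τ
      rw [← integral_comp_measurePreserving h2 m1]
      refine integral_congr_ae ?_
      filter_upwards [hodd] with p hp
      rw [hp]
      ring
  -- The reflected sequence is minimizing too, so its limits `-q ∘ σ` and `-trace q ∘ σ` agree
  -- almost everywhere with `q` and `trace q`. Continuity upgrades the first equality to every point
  -- of the square.
  have hψ : IsMinimizing τ g fun n p => -φ n (σ p) :=
    ⟨fun n => ((hφ.contDiff n).comp hσ).neg, hφ.tendsto.congr fun n => (hs n).symm⟩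
  obtain ⟨e1, e2⟩ := ae_eq_of_isMinimizing hτ hg hφ hψ ha.val (ha.val.comp h1).neg ha.bdry
    (ha.bdry.comp h2).neg
  exact ⟨Measure.eqOn_open_of_ae_eq e1 isOpen_square hq.1.1.continuousOn
    (hq.1.1.continuousOn.comp hσ.continuous.continuousOn hm).neg, e2⟩

/-! ### Euler–Lagrange equation and existence -/

theorem dx_const_mul (s : ℝ) {ψ : ℝ × ℝ → ℝ} (hψ : ContDiff ℝ ∞ ψ) (p : ℝ × ℝ) :
    dx (fun p => s * ψ p) p = s * dx ψ p := by
  simp [dx, fderiv_const_mul (hψ.differentiable (by simp) p)]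

theorem dy_const_mul (s : ℝ) {ψ : ℝ × ℝ → ℝ} (hψ : ContDiff ℝ ∞ ψ) (p : ℝ × ℝ) :
    dy (fun p => s * ψ p) p = s * dy ψ p := by
  simp [dy, fderiv_const_mul (hψ.differentiable (by simp) p)]

theorem integral_sub_smul_sq {α : Type*} [MeasurableSpace α] {μ : Measure α} {a b : α → ℝ}
    (ha : MemLp a 2 μ) (hb : MemLp b 2 μ) (s : ℝ) :
    ∫ p, (a p - s * b p) ^ 2 ∂μ =
      ∫ p, a p ^ 2 ∂μ - 2 * s * ∫ p, a p * b p ∂μ + s ^ 2 * ∫ p, b p ^ 2 ∂μ := by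
  have i1 := ha.integrable_sq
  have i2 := hb.integrable_sq
  have i3 : Integrable (fun p => a p * b p) μ := ha.integrable_mul hb
  have i4 : Integrable (fun p => a p ^ 2 - 2 * s * (a p * b p)) μ := i1.sub (i3.const_mul _)
  rw [← integral_const_mul, ← integral_const_mul, ← integral_sub i1 (i3.const_mul _),
    ← integral_add i4 (i2.const_mul _)]
  exact integral_congr_ae (ae_of_all _ fun p => by ring)

/-- The Euler–Lagrange equation for the limit of a minimizing sequence. -/
theorem IsMinimizing.integral_grad_mul_grad_eq_zero (hτ : 0 < τ) (hg : MemLp g 2 arcLength)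
    {φ : ℕ → ℝ × ℝ → ℝ} (hφ : IsMinimizing τ g φ) {w₁ w₂ t ψ : ℝ × ℝ → ℝ}
    (h1 : L2Tendsto area (fun n => dx (φ n)) w₁) (h2 : L2Tendsto area (fun n => dy (φ n)) w₂)
    (h3 : L2Tendsto arcLength φ t) (hψ : IsTest ψ) :
    ∫ p, w₁ p * dx ψ p ∂area + ∫ p, w₂ p * dy ψ p ∂area = 0 := by
  have hm : energy τ g w₁ w₂ t = energyInf τ g :=
    tendsto_nhds_unique (tendsto_energy hg h1 h2 h3) hφ.tendsto
  have m1 := memLp_dx hψ.1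
  have m2 := memLp_dy hψ.1
  have hle : ∀ s : ℝ, energyInf τ g ≤ energy τ g (fun p => w₁ p - s * dx ψ p)
      (fun p => w₂ p - s * dy ψ p) t := fun s => by
    refine ge_of_tendsto' (tendsto_energy hg (h1.sub (.const (m1.const_mul s)))
      (h2.sub (.const (m2.const_mul s))) h3) fun n => ?_
    have hs : ContDiff ℝ ∞ fun p => s * ψ p := contDiff_const.mul hψ.1
    refine (energyInf_le hτ ((hφ.contDiff n).sub hs)).trans (le_of_eq ?_)
    refine energy_congr (ae_of_all _ fun p => ?_) (ae_of_all _ fun p => ?_) ?_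
    · rw [dx_sub (hφ.contDiff n) hs, dx_const_mul s hψ.1]
    · rw [dy_sub (hφ.contDiff n) hs, dy_const_mul s hψ.1]
    -- The variation has support inside the open square and does not touch the boundary term.
    · filter_upwards [ae_arcLength_mem] with p hp
      rw [image_eq_zero_of_notMem_tsupport fun h => hp.2 (hψ.2.2 h), mul_zero, sub_zero]
  set B := ∫ p, w₁ p * dx ψ p ∂area + ∫ p, w₂ p * dy ψ p ∂area with hB
  set C := ∫ p, dx ψ p ^ 2 ∂area + ∫ p, dy ψ p ^ 2 ∂area with hC
  have hC0 : 0 ≤ C := add_nonneg (integral_nonneg fun _ => sq_nonneg _)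
    (integral_nonneg fun _ => sq_nonneg _)
  have key : ∀ s : ℝ, 0 ≤ -2 * s * B + s ^ 2 * C := fun s => by
    have := hle s
    have l1 : MemLp (fun p => w₁ p - s * dx ψ p) 2 area := h1.memLp_lim.sub (m1.const_mul s)
    have l2 : MemLp (fun p => w₂ p - s * dy ψ p) 2 area := h2.memLp_lim.sub (m2.const_mul s)
    rw [← hm, energy_eq _ h1.memLp_lim h2.memLp_lim,
      energy_eq _ l1 l2, integral_sub_smul_sq h1.memLp_lim m1, integral_sub_smul_sq h2.memLp_lim m2] at this
    rw [hB, hC]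
    linarith
  -- The quadratic `-2sB + s²C` is nonnegative for all `s`, which forces `B = 0`. The value `s = B /
  -- (C + 1)` shows it without a case distinction on `C = 0`.
  have h := key (B / (C + 1))
  have e : -2 * (B / (C + 1)) * B + (B / (C + 1)) ^ 2 * C = -((C + 2) * (B / (C + 1)) ^ 2) := by
    field_simp
    ring
  rw [e] at h
  have h4 : (B / (C + 1)) ^ 2 = 0 := by nlinarith [sq_nonneg (B / (C + 1))]
  have h5 := pow_eq_zero_iff two_ne_zero |>.1 h4
  exact (div_eq_zero_iff.1 h5).resolve_right (by positivity)

/-- Existence of a minimizer in the admissible class. -/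
theorem exists_isArgMin (hτ : 0 < τ) (hg : MemLp g 2 arcLength) : ∃ q, IsArgMin τ g q := by
  obtain ⟨φ, hφ⟩ := exists_isMinimizing (g := g) hτ
  have hc := hφ.contDiff
  obtain ⟨d0, d1, d2, d3⟩ := hφ.tendsto_dist hτ hg hφ
  obtain ⟨u, hu⟩ := exists_L2Tendsto (fun n => memLp_area (hc n).continuous) d0
  obtain ⟨w₁, hw₁⟩ := exists_L2Tendsto (fun n => memLp_dx (hc n)) d1
  obtain ⟨w₂, hw₂⟩ := exists_L2Tendsto (fun n => memLp_dy (hc n)) d2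
  obtain ⟨t, ht⟩ := exists_L2Tendsto (fun n => memLp_arcLength (hc n).continuous) d3
  have ux : ∀ ψ, IsTest ψ → ∫ p, u p * dx ψ p ∂area = -∫ p, w₁ p * ψ p ∂area := fun ψ hψ =>
    tendsto_nhds_unique (hu.integral_mul (.const (memLp_test hψ.dx)))
      ((hw₁.integral_mul (.const (memLp_test hψ))).neg.congr fun n =>
        (integral_mul_dx (hc n).contDiffOn hψ).symm)
  have uy : ∀ ψ, IsTest ψ → ∫ p, u p * dy ψ p ∂area = -∫ p, w₂ p * ψ p ∂area := fun ψ hψ =>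
    tendsto_nhds_unique (hu.integral_mul (.const (memLp_test hψ.dy)))
      ((hw₂.integral_mul (.const (memLp_test hψ))).neg.congr fun n =>
        (integral_mul_dy (hc n).contDiffOn hψ).symm)
  -- Testing the weak derivatives of `u` with `dx ψ` and `dy ψ` turns the Euler–Lagrange equation
  -- into weak harmonicity.
  obtain ⟨q, hq, huq⟩ := weyl hu.memLp_lim fun ψ hψ => by
    have i1 : Integrable (fun p => u p * dx (dx ψ) p) area :=
      hu.memLp_lim.integrable_mul (memLp_test hψ.dx.dx)
    have i2 : Integrable (fun p => u p * dy (dy ψ) p) area :=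
      hu.memLp_lim.integrable_mul (memLp_test hψ.dy.dy)
    simp only [mul_add]
    rw [integral_add i1 i2, ux _ hψ.dx, uy _ hψ.dy]
    linarith [hφ.integral_grad_mul_grad_eq_zero hτ hg hw₁ hw₂ ht hψ]
  have hswap : ∀ f : ℝ × ℝ → ℝ, ∫ p, q p * f p ∂area = ∫ p, u p * f p ∂area := fun f => by
    refine integral_congr_ae ?_
    filter_upwards [huq] with p hp
    rw [hp]
  have e1 : w₁ =ᵐ[area] dx q := ae_eq_dx hq hw₁.memLp_lim fun ψ hψ => by rw [hswap, ux ψ hψ]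
  have e2 : w₂ =ᵐ[area] dy q := ae_eq_dy hq hw₂.memLp_lim fun ψ hψ => by rw [hswap, uy ψ hψ]
  have happ : Approximates φ q t :=
    ⟨hc, hu.congr_lim huq, hw₁.congr_lim e1, hw₂.congr_lim e2, ht⟩
  have hadm : Admissible q :=
    ⟨hq, .of_contDiffOn hq happ.val.memLp_lim happ.dx.memLp_lim happ.dy.memLp_lim⟩
  have hJ : J q τ g = energyInf τ g := by
    have : J q τ g = energy τ g (dx q) (dy q) t :=
      energy_congr (ae_eq_refl _) (ae_eq_refl _) (happ.isTrace.trace_ae_eq hadm)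
    rw [this]
    exact tendsto_nhds_unique (tendsto_energy hg happ.dx happ.dy happ.bdry) hφ.tendsto
  exact ⟨q, hadm, fun r hr => hJ ▸ energyInf_le_J hτ hg hr⟩

end Energy

/-! ### The boundary datum and the limiting profile -/

theorem measurable_trapezoid (d : ℝ) : Measurable (trapezoid d) := by
  unfold trapezoid; fun_prop

theorem trapezoid_one_sub (d t : ℝ) : trapezoid d (1 - t) = trapezoid d t := by
  simp only [trapezoid, sub_sub_cancel]
  rw [min_left_comm, min_comm ((1 - t) / d), min_left_comm 1]

theorem trapezoid_zero {d : ℝ} (hd : 0 < d) : trapezoid d 0 = 0 := by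
  rw [trapezoid, zero_div, sub_zero]
  exact min_eq_left (le_min zero_le_one (by positivity))

theorem trapezoid_one {d : ℝ} (hd : 0 < d) : trapezoid d 1 = 0 := by
  rw [← trapezoid_zero hd, ← trapezoid_one_sub, sub_self]

theorem abs_trapezoid_le {d t : ℝ} (hd : 0 < d) (ht : t ∈ Icc (0 : ℝ) 1) :
    |trapezoid d t| ≤ 1 := by
  have h : 0 ≤ trapezoid d t := le_min (div_nonneg ht.1 hd.le)
    (le_min zero_le_one (div_nonneg (sub_nonneg.2 ht.2) hd.le))
  rw [abs_of_nonneg h]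
  exact (min_le_right _ _).trans (min_le_left _ _)

theorem gBdry_snd (d : ℝ) (p : ℝ × ℝ) : (gBdry d p).2 = 0 := by
  unfold gBdry
  split_ifs <;> rfl

theorem gBdry_horizontal (d x : ℝ) {y : ℝ} (hy : y = 0 ∨ y = 1) :
    (gBdry d (x, y)).1 = trapezoid d x := by
  rw [gBdry, if_pos hy]

/-- At the corners the definition uses the horizontal formula; the vertical one agrees because
`trapezoid` vanishes at `0` and `1`. -/
theorem gBdry_vertical {d : ℝ} (hd : 0 < d) {x : ℝ} (y : ℝ) (hx : x = 0 ∨ x = 1) :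
    (gBdry d (x, y)).1 = -trapezoid d y := by
  by_cases hy : y = 0 ∨ y = 1
  · rw [gBdry_horizontal d x hy]
    rcases hx with rfl | rfl <;> rcases hy with rfl | rfl <;>
      simp [trapezoid_zero hd, trapezoid_one hd]
  · rw [gBdry, if_neg hy, if_pos hx]

theorem eq_of_mem_squareBoundary {x y : ℝ} (h : (x, y) ∈ squareBoundary) :
    (y = 0 ∨ y = 1) ∨ (x = 0 ∨ x = 1) := by
  by_contra! h'
  obtain ⟨⟨hx, hy⟩, hn⟩ := h
  exact hn ⟨⟨lt_of_le_of_ne hx.1 h'.2.1.symm, lt_of_le_of_ne hx.2 h'.2.2⟩,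
    lt_of_le_of_ne hy.1 h'.1.1.symm, lt_of_le_of_ne hy.2 h'.1.2⟩

theorem one_sub_eq_zero_or_one {x : ℝ} (h : x = 0 ∨ x = 1) : 1 - x = 0 ∨ 1 - x = 1 := by
  rcases h with rfl | rfl <;> simp

theorem gBdry_flip {d : ℝ} (hd : 0 < d) {x y : ℝ} (h : (x, y) ∈ squareBoundary) :
    (gBdry d (x, y)).1 = -(gBdry d (y, x)).1 := by
  rcases eq_of_mem_squareBoundary h with h | h
  · rw [gBdry_horizontal d x h, gBdry_vertical hd x h, neg_neg]
  · rw [gBdry_vertical hd y h, gBdry_horizontal d y h]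

theorem gBdry_antiflip {d : ℝ} (hd : 0 < d) {x y : ℝ} (h : (x, y) ∈ squareBoundary) :
    (gBdry d (x, y)).1 = -(gBdry d (1 - y, 1 - x)).1 := by
  rcases eq_of_mem_squareBoundary h with h | h
  · rw [gBdry_horizontal d x h, gBdry_vertical hd _ (one_sub_eq_zero_or_one h), neg_neg,
      trapezoid_one_sub]
  · rw [gBdry_vertical hd y h, gBdry_horizontal d _ (one_sub_eq_zero_or_one h),
      trapezoid_one_sub]

theorem memLp_gBdry_fst {d : ℝ} (hd : 0 < d) : MemLp (fun p => (gBdry d p).1) 2 arcLength := by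
  have hm : Measurable fun p => (gBdry d p).1 := by
    have hT := measurable_trapezoid d
    have h1 : MeasurableSet {p : ℝ × ℝ | p.2 = 0 ∨ p.2 = 1} :=
      (measurableSet_eq_fun measurable_snd measurable_const).union
        (measurableSet_eq_fun measurable_snd measurable_const)
    have h2 : MeasurableSet {p : ℝ × ℝ | p.1 = 0 ∨ p.1 = 1} :=
      (measurableSet_eq_fun measurable_fst measurable_const).union
        (measurableSet_eq_fun measurable_fst measurable_const)
    have h3 : Measurable (gBdry d) := Measurable.ite h1 ((hT.comp measurable_fst).prodMk measurable_const)
      (Measurable.ite h2 ((hT.comp measurable_snd).neg.prodMk measurable_const) measurable_const)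
    exact measurable_fst.comp h3
  refine MemLp.of_bound hm.aestronglyMeasurable 1 ?_
  filter_upwards [ae_arcLength_mem] with ⟨x, y⟩ hp
  rw [Real.norm_eq_abs]
  rcases eq_of_mem_squareBoundary hp with h | h
  · rw [gBdry_horizontal d x h]
    exact abs_trapezoid_le hd hp.1.1
  · rw [gBdry_vertical hd y h, abs_neg]
    exact abs_trapezoid_le hd hp.1.2

theorem memLp_gBdry_snd (d : ℝ) : MemLp (fun p => (gBdry d p).2) 2 arcLength := by
  simp only [gBdry_snd]
  exact MemLp.zero'

theorem mapsTo_flip : MapsTo flip square square := fun _ h => ⟨h.2, h.1⟩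

theorem mapsTo_antiflip : MapsTo antiflip square square := fun _ h =>
  ⟨⟨sub_pos.2 h.2.2, sub_lt_self 1 h.2.1⟩, sub_pos.2 h.1.2, sub_lt_self 1 h.1.1⟩

/-- With homogeneous datum the minimizer vanishes. -/
theorem IsArgMin.eq_zero {τ : ℝ} (hτ : 0 < τ) {g q : ℝ × ℝ → ℝ} (hg : ∀ p, g p = 0)
    (hq : IsArgMin τ g q) :
    (∀ p ∈ square, q p = 0) ∧ ∀ᵐ p ∂arcLength, trace q p = 0 := by
  obtain rfl : g = fun _ => 0 := funext hg
  -- The zero datum is odd under the identity, so the minimizer equals its own negative.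
  obtain ⟨h1, h2⟩ := hq.odd (σ := id) hτ MemLp.zero' contDiff_id (.id _) (.id _) (mapsTo_id _)
    (fun _ _ _ => rfl) (by simp)
  exact ⟨fun p hp => self_eq_neg.1 (h1 p hp), h2.mono fun p hp => self_eq_neg.1 hp⟩

theorem exists_isLimitProfile {W d : ℝ} (hW : 0 < W) (hd : 0 < d) : ∃ Q, IsLimitProfile W d Q := by
  obtain ⟨q₁, h1⟩ := exists_isArgMin hW (memLp_gBdry_fst hd)
  obtain ⟨q₂, h2⟩ := exists_isArgMin hW (memLp_gBdry_snd d)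
  refine ⟨fun p => !![q₁ p, q₂ p; q₂ p, -q₁ p], fun p _ => ?_, fun p _ => ?_, ?_, ?_⟩
  · exact Matrix.IsSymm.ext fun i j => by fin_cases i <;> fin_cases j <;> rfl
  · simp [Matrix.trace_fin_two]
  · simpa using h1
  · simpa using h2

theorem IsLimitProfile.apply_one_zero {W d : ℝ} {Q : ℝ × ℝ → Matrix (Fin 2) (Fin 2) ℝ}
    (h : IsLimitProfile W d Q) {p : ℝ × ℝ} (hp : p ∈ square) : Q p 1 0 = Q p 0 1 :=
  (h.symm p hp).apply 0 1

theorem IsLimitProfile.apply_one_one {W d : ℝ} {Q : ℝ × ℝ → Matrix (Fin 2) (Fin 2) ℝ}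
    (h : IsLimitProfile W d Q) {p : ℝ × ℝ} (hp : p ∈ square) : Q p 1 1 = -Q p 0 0 := by
  have := h.traceless p hp
  rw [Matrix.trace_fin_two] at this
  linarith

theorem IsLimitProfile.eqOn {W d : ℝ} (hW : 0 < W) (hd : 0 < d)
    {Q Q' : ℝ × ℝ → Matrix (Fin 2) (Fin 2) ℝ} (h : IsLimitProfile W d Q)
    (h' : IsLimitProfile W d Q') : EqOn Q Q' square := fun p hp => by
  have h1 : Q p 0 0 = Q' p 0 0 := h.min11.eqOn hW (memLp_gBdry_fst hd) h'.min11 hp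
  have h2 : Q p 0 1 = Q' p 0 1 := h.min12.eqOn hW (memLp_gBdry_snd d) h'.min12 hp
  ext i j
  fin_cases i <;> fin_cases j <;>
    simp [h1, h2, h.apply_one_zero hp, h'.apply_one_zero hp, h.apply_one_one hp,
      h'.apply_one_one hp]

theorem IsLimitProfile.eq_zero {W d : ℝ} {Q : ℝ × ℝ → Matrix (Fin 2) (Fin 2) ℝ}
    (h : IsLimitProfile W d Q) {p : ℝ × ℝ} (hp : p ∈ square) (h1 : Q p 0 0 = 0)
    (h2 : Q p 0 1 = 0) : Q p = 0 := by
  ext i j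
  fin_cases i <;> fin_cases j <;> simp [h1, h2, h.apply_one_zero hp, h.apply_one_one hp]

theorem IsLimitProfile.odd_flip {W d : ℝ} (hW : 0 < W) (hd : 0 < d)
    {Q : ℝ × ℝ → Matrix (Fin 2) (Fin 2) ℝ} (h : IsLimitProfile W d Q) :
    (∀ p ∈ square, Q p 0 0 = -Q (flip p) 0 0) ∧ ∀ᵐ p ∂arcLength,
      trace (fun p => Q p 0 0) p = -trace (fun p => Q p 0 0) (flip p) := by
  refine h.min11.odd hW (memLp_gBdry_fst hd) contDiff_flip measurePreserving_flip_area
    measurePreserving_flip_arcLength mapsTo_flip (fun φ hφ p => ?_) ?_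
  · rw [dx_comp_flip hφ, dy_comp_flip hφ, add_comm]
  · filter_upwards [ae_arcLength_mem] with ⟨x, y⟩ hp
    rw [gBdry_flip hd hp, neg_neg, flip]

theorem IsLimitProfile.odd_antiflip {W d : ℝ} (hW : 0 < W) (hd : 0 < d)
    {Q : ℝ × ℝ → Matrix (Fin 2) (Fin 2) ℝ} (h : IsLimitProfile W d Q) :
    (∀ p ∈ square, Q p 0 0 = -Q (antiflip p) 0 0) ∧ ∀ᵐ p ∂arcLength,
      trace (fun p => Q p 0 0) p = -trace (fun p => Q p 0 0) (antiflip p) := by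
  refine h.min11.odd hW (memLp_gBdry_fst hd) contDiff_antiflip measurePreserving_antiflip_area
    measurePreserving_antiflip_arcLength mapsTo_antiflip (fun φ hφ p => ?_) ?_
  · rw [dx_comp_antiflip hφ, dy_comp_antiflip hφ, neg_sq, neg_sq, add_comm]
  · filter_upwards [ae_arcLength_mem] with ⟨x, y⟩ hp
    rw [gBdry_antiflip hd hp, neg_neg, antiflip]

end
end WeakAnchoring

theorem mainTheorem4 (W d : ℝ) (hW : 0 < W) (hd₀ : 0 < d) (hd : d < 1 / 2) :
    -- the boundary datum
    (∀ x y : ℝ, (x, y) ∈ WeakAnchoring.squareBoundary →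
      (WeakAnchoring.gBdry d (x, y)).2 = 0 ∧
      (WeakAnchoring.gBdry d (x, y)).1 = -(WeakAnchoring.gBdry d (y, x)).1 ∧
      (WeakAnchoring.gBdry d (x, y)).1 = -(WeakAnchoring.gBdry d (1 - y, 1 - x)).1) ∧
    -- existence and uniqueness of the limiting profile
    (∃ Q, WeakAnchoring.IsLimitProfile W d Q) ∧
    (∀ Q Q', WeakAnchoring.IsLimitProfile W d Q → WeakAnchoring.IsLimitProfile W d Q' →
      EqOn Q Q' WeakAnchoring.square) ∧
    ∀ Q, WeakAnchoring.IsLimitProfile W d Q →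
      -- the off-diagonal entry vanishes, in the square and on its boundary
      (∀ p ∈ WeakAnchoring.square, Q p 0 1 = 0) ∧
      (∀ᵐ p ∂WeakAnchoring.arcLength, WeakAnchoring.trace (fun p => Q p 0 1) p = 0) ∧
      -- antisymmetry of the diagonal entry, in the square and on its boundary
      (∀ x y : ℝ, (x, y) ∈ WeakAnchoring.square →
        Q (x, y) 0 0 = -Q (y, x) 0 0 ∧ Q (x, y) 0 0 = -Q (1 - y, 1 - x) 0 0) ∧
      (∀ᵐ p ∂WeakAnchoring.arcLength,
        WeakAnchoring.trace (fun p => Q p 0 0) p =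
          -WeakAnchoring.trace (fun p => Q p 0 0) (p.2, p.1) ∧
        WeakAnchoring.trace (fun p => Q p 0 0) p =
          -WeakAnchoring.trace (fun p => Q p 0 0) (1 - p.2, 1 - p.1)) ∧
      -- the cross: the whole tensor vanishes on both diagonals
      (∀ x ∈ Ioo (0 : ℝ) 1, Q (x, x) 0 0 = 0 ∧ Q (x, 1 - x) 0 0 = 0) ∧
      (∀ x ∈ Ioo (0 : ℝ) 1, Q (x, x) = 0 ∧ Q (x, 1 - x) = 0) := by
  refine ⟨fun x y h => ⟨WeakAnchoring.gBdry_snd d _, WeakAnchoring.gBdry_flip hd₀ h,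
    WeakAnchoring.gBdry_antiflip hd₀ h⟩, WeakAnchoring.exists_isLimitProfile hW hd₀,
    fun Q Q' h h' => h.eqOn hW hd₀ h', fun Q h => ?_⟩
  obtain ⟨z1, z2⟩ := h.min12.eq_zero hW (WeakAnchoring.gBdry_snd d)
  obtain ⟨f1, f2⟩ := h.odd_flip hW hd₀
  obtain ⟨a1, a2⟩ := h.odd_antiflip hW hd₀
  have hm : ∀ x ∈ Ioo (0 : ℝ) 1, (x, x) ∈ WeakAnchoring.square ∧
      (x, 1 - x) ∈ WeakAnchoring.square := fun x hx =>
    ⟨⟨hx, hx⟩, hx, sub_pos.2 hx.2, sub_lt_self 1 hx.1⟩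
  have hdiag : ∀ x ∈ Ioo (0 : ℝ) 1, Q (x, x) 0 0 = 0 ∧ Q (x, 1 - x) 0 0 = 0 := fun x hx => by
    -- Each diagonal is fixed pointwise by its own reflection, so antisymmetry reads `q = -q` there.
    refine ⟨self_eq_neg.1 (f1 _ (hm x hx).1), self_eq_neg.1 ?_⟩
    have := a1 _ (hm x hx).2
    rwa [WeakAnchoring.antiflip, sub_sub_cancel] at this
  exact ⟨z1, z2, fun x y hp => ⟨f1 _ hp, a1 _ hp⟩, f2.and a2, hdiag, fun x hx =>
    ⟨h.eq_zero (hm x hx).1 (hdiag x hx).1 (z1 _ (hm x hx).1),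
      h.eq_zero (hm x hx).2 (hdiag x hx).2 (z1 _ (hm x hx).2)⟩⟩
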